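/- Setting. Let $\mathcal X\subseteq\mathbb R^{n_1}$ and $\Sigma\subseteq\mathbb R^{n_2}$ be open, and for $(\xi,\sigma)\in\mathcal X\times\Sigma$ let $\delta_{\xi,\sigma}$ be a (Borel) probability measure on $\mathcal X$. Let $\mathsf A=\{a_1,\dots,a_m\}$ be a linearly independent set of continuous functions $a_i:\mathcal X\to\mathbb R$, each integrable with respect to every $\delta_{\xi,\sigma}$, and suppose there is $\sigma_0\in\overline\Sigma$ with $$\lim_{\Sigma\ni\sigma\to\sigma_0}\int_{\mathcal X}a_i\,\mathrm d\delta_{\xi,\sigma}=a_i(\xi)\qquad\text{for all }\xi\in\mathcal X,\ i=1,\dots,m.$$ Put $b_i(x,\sigma)=\int_{\mathcal X}a_i(y)\,\mathrm d\delta_{x,\sigma}(y)$, $t_{\mathsf A}=(b_1,\dots,b_m)$, and for $k\in\mathbb N_0$, $C\in\mathbb R_{\ge0}^k$, $X\in\mathcal X^k$, $\bar\sigma\in\Sigma^k$, $$T_{k,\mathsf A}(C,X,\bar\sigma)=\sum_{j=1}^k c_j\,t_{\mathsf A}(x_j,\sigma_j)\in\mathbb R^m .$$ Let $\mathcal T_{\mathsf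 A}=\operatorname{range}T_{m,\mathsf A}$. For $s\in\mathcal T_{\mathsf A}$ let $\mathcal C^M_{\mathsf A}(s)$ be the least $k\in\mathbb N_0$ such that $s$ is the moment sequence $T_{k,\mathsf A}(C,X,\bar\sigma)$ of a mixture $\sum_{j=1}^k c_j\delta_{x_j,\sigma_j}$ with $k$ components ($c_j>0$), and let $\mathcal C^M_{\mathsf A}=\max_{s\in\mathcal T_{\mathsf A}}\mathcal C^M_{\mathsf A}(s)$. If the $b_i$ are $C^1$ on $\mathcal X\times\Sigma$, let $\mathcal N^M_{\mathsf A}$ be the least $k\in\mathbb N_0$ such that the total derivative $DT_{k,\mathsf A}$ (with respect to all of $C,X,\bar\sigma$; $T_{k,\mathsf A}$ is extended to $C\in\mathbb R^k$ by the same formula) has full rank $m$ at some point $(C,X,\bar\sigma)\in\mathbb R_{\ge0}^k\times\mathcal X^k\times\Sigma^k$. Theorem. (1) If the $b_i$ are $C^r$ on $\mathcal X\times\Sigma$ for some $r\in\{1,2,\dots,\infty\}$ with $r>\mathcal N^M_{\mathsf A}\,(n_1+n_2+1)-m$, then $$\left\lceil\frac{m}{n_1+n_2+1}\right\rceil\ \le\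 \mathcal N^M_{\mathsf A}\ \le\ \mathcal C^M_{\mathsf A}.$$ (2) Gaussian mixtures. Let $\mathcal X=\mathbb R^n$, let $\Sigma$ be the set of symmetric non-singular real $n\times n$ matrices, and let $\delta_{\xi,\sigma}$ have Lebesgue density $$x\mapsto\frac{\exp\left(-\tfrac12(x-\xi)^T\sigma^{-2}(x-\xi)\right)}{\sqrt{(2\pi)^n\det(\sigma)^2}} .$$ Let $\mathsf A=\{a_1,\dots,a_m\}$ be linearly independent continuous functions on $\mathbb R^n$, integrable with respect to all these $\delta_{\xi,\sigma}$. Then, with $\mathcal C^M_{\mathsf A}$ defined as above, $$\left\lceil\frac{2m}{(n+1)(n+2)}\right\rceil\ \le\ \mathcal C^M_{\mathsf A}.$$ -/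

import Mathlib

open MeasureTheory Filter Topology

noncomputable section

namespace MixtureMoment

/-- The mixture moment function `b_i(x, σ) = ∫_X a_i(y) dδ_{x,σ}(y)`. -/
def momentFn {E P : Type*} [MeasurableSpace E] {m : ℕ} (X : Set E) (δ : E → P → Measure E)
    (a : Fin m → E → ℝ) (i : Fin m) (p : E × P) : ℝ :=
  ∫ y in X, a i y ∂(δ p.1 p.2)

/-- The moment map `T_k(C, (x_j), (σ_j)) = ∑_j c_j • (b_1(x_j, σ_j), …, b_m(x_j, σ_j))`, where
`q = (C, (x_j), (σ_j))`. -/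
def momentMap {E P : Type*} [MeasurableSpace E] {m : ℕ} (X : Set E) (δ : E → P → Measure E)
    (a : Fin m → E → ℝ) (k : ℕ) (q : (Fin k → ℝ) × (Fin k → E) × (Fin k → P)) : Fin m → ℝ :=
  fun i => ∑ j, q.1 j * momentFn X δ a i (q.2.1 j, q.2.2 j)

/-- The domain `[0,∞)^k × X^k × S^k` of the moment map `T_k`. -/
def momentDomain {E P : Type*} (X : Set E) (S : Set P) (k : ℕ) :
    Set ((Fin k → ℝ) × (Fin k → E) × (Fin k → P)) :=
  {q | (∀ j, 0 ≤ q.1 j) ∧ (∀ j, q.2.1 j ∈ X) ∧ (∀ j, q.2.2 j ∈ S)}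

/-- The moment cone of mixtures, the range of `T_m`, where `m` is the number of functions `a_i`. -/
def mixtureCone {E P : Type*} [MeasurableSpace E] {m : ℕ} (X : Set E) (S : Set P)
    (δ : E → P → Measure E) (a : Fin m → E → ℝ) : Set (Fin m → ℝ) :=
  momentMap X δ a m '' momentDomain X S m

/-- `s` is the moment sequence of a mixture `∑_j c_j δ_{x_j,σ_j}` with `k` components, `c_j > 0`. -/
def HasMixtureRep {E P : Type*} [MeasurableSpace E] {m : ℕ} (X : Set E) (S : Set P)
    (δ : E → P → Measure E) (a : Fin m → E → ℝ) (s : Fin m → ℝ) (k : ℕ) : Prop :=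
  ∃ q ∈ momentDomain X S k, (∀ j, 0 < q.1 j) ∧ momentMap X δ a k q = s

/-- The Carathéodory number of mixtures of one moment sequence `s`. -/
def caraAt {E P : Type*} [MeasurableSpace E] {m : ℕ} (X : Set E) (S : Set P)
    (δ : E → P → Measure E) (a : Fin m → E → ℝ) (s : Fin m → ℝ) : ℕ∞ :=
  ⨅ (k : ℕ) (_ : HasMixtureRep X S δ a s k), (k : ℕ∞)

/-- The Carathéodory number of mixtures. -/
def cara {E P : Type*} [MeasurableSpace E] {m : ℕ} (X : Set E) (S : Set P)
    (δ : E → P → Measure E) (a : Fin m → E → ℝ) : ℕ∞ :=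
  ⨆ s ∈ mixtureCone X S δ a, caraAt X S δ a s

/-- The total derivative of `T_k` has full rank `m` at some point of its domain. For open `X` and `S`
and at points with `x_j ∈ X`, `σ_j ∈ S`, the derivative only depends on the values of the `b_i` on
`X × S`; `T_k` is extended to all real coefficients `c_j` by the same formula. -/
def HasFullRank {E P : Type*} [NormedAddCommGroup E] [NormedSpace ℝ E] [MeasurableSpace E]
    [NormedAddCommGroup P] [NormedSpace ℝ P] {m : ℕ} (X : Set E) (S : Set P)
    (δ : E → P → Measure E) (a : Fin m → E → ℝ) (k : ℕ) : Prop :=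
  ∃ q ∈ momentDomain X S k,
    Module.finrank ℝ (LinearMap.range (fderiv ℝ (momentMap X δ a k) q).toLinearMap) = m

/-- The least `k` such that the total derivative of `T_k` has full rank. -/
def rankNumber {E P : Type*} [NormedAddCommGroup E] [NormedSpace ℝ E] [MeasurableSpace E]
    [NormedAddCommGroup P] [NormedSpace ℝ P] {m : ℕ} (X : Set E) (S : Set P)
    (δ : E → P → Measure E) (a : Fin m → E → ℝ) : ℕ∞ :=
  ⨅ (k : ℕ) (_ : HasFullRank X S δ a k), (k : ℕ∞)

/-- The density `exp(-½ (x-ξ)ᵀ σ⁻² (x-ξ)) / √((2π)ⁿ det(σ)²)`. -/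
def gaussianDensity {n : ℕ} (ξ : EuclideanSpace ℝ (Fin n)) (σ : Matrix (Fin n) (Fin n) ℝ)
    (x : EuclideanSpace ℝ (Fin n)) : ℝ :=
  Real.exp (-(1 / 2 : ℝ) *
      ((x - ξ).ofLp ⬝ᵥ (Matrix.mulVec (σ⁻¹ * σ⁻¹) (x - ξ).ofLp))) /
    Real.sqrt ((2 * Real.pi) ^ n * σ.det ^ 2)

/-- The Gaussian measure on `ℝⁿ` with parameters `ξ` and `σ`. -/
def gaussianMeasure {n : ℕ} (ξ : EuclideanSpace ℝ (Fin n)) (σ : Matrix (Fin n) (Fin n) ℝ) :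
    Measure (EuclideanSpace ℝ (Fin n)) :=
  volume.withDensity (fun x => ENNReal.ofReal (gaussianDensity ξ σ x))

/-- The symmetric non-singular `n × n` matrices. -/
def symNonsing (n : ℕ) : Set (Matrix (Fin n) (Fin n) ℝ) :=
  {σ | σ.IsSymm ∧ σ.det ≠ 0}

end MixtureMoment

end

/-! Linear independence passes from the `a i` to the moment functions `b_i`: in the general case
because the `b_i` tend to the `a i` as `σ → σ₀`, in the Gaussian case because a continuous function
whose Gaussian integrals all vanish is zero. The vectors `(b_i(x, σ))_i` then contain a basis of
`ℝ^m`, so the moment cone contains an open set and has positive volume. If for every `k < N` the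
moments of `k`-component mixtures form a null set, such mixtures cannot exhaust the cone, and `N ≤
cara` (`le_cara_of_volume_image_eq_zero`). Both upper estimates in terms of `cara` are instances of
this.

In the general case `N` is the rank number. For `k < N` every point of the domain of `T_k` is
critical, and Sard's theorem (`measure_image_critical_eq_zero`) gives the null set. Sard is proved
by splitting critical points by rank, straightening the nondegenerate directions, and using Fubini.
What remains are critical values of rank zero, whose Hausdorff dimension is at most `dim / r` by A.
P. Morse's decomposition into flat pieces (`countablyFlat_self`). The lower bound on the rank number
only counts parameters.

In the Gaussian case no derivative is needed. A weighted density `c · density` is the exponential of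
a polynomial of degree at most two, so its moments are values of Laplace transforms on a space of
dimension `(n+1)(n+2)/2`; the weight `c` is absorbed into the constant term. These transforms are
differences of convex functions, hence locally Lipschitz, and locally Lipschitz maps do not raise
Hausdorff dimension. -/

noncomputable section

/-! ### Local charts and orders of vanishing -/

/-- Straightening of a map with surjective derivative: it is the first coordinate of a `C^r` chart. -/
theorem ContDiffAt.exists_openPartialHomeomorph_fst {E R : Type*}
    [NormedAddCommGroup E] [NormedSpace ℝ E] [FiniteDimensional ℝ E]
    [NormedAddCommGroup R] [NormedSpace ℝ R] [FiniteDimensional ℝ R]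
    {r : ℕ} (hr : 1 ≤ r) {h : E → R} {x₀ : E} (hh : ContDiffAt ℝ r h x₀)
    (hsurj : LinearMap.range (fderiv ℝ h x₀).toLinearMap = ⊤) :
    ∃ K : Submodule ℝ E, Module.finrank ℝ R + Module.finrank ℝ K = Module.finrank ℝ E ∧
      ∃ Φ : OpenPartialHomeomorph E (R × K), x₀ ∈ Φ.source ∧ (∀ x ∈ Φ.source, (Φ x).1 = h x) ∧
      (∀ x ∈ Φ.source, ContDiffAt ℝ r h x) ∧ ∀ y ∈ Φ.target, ContDiffAt ℝ r Φ.symm y := by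
  have hr0 : (r : WithTop ℕ∞) ≠ 0 := by exact_mod_cast (by omega : r ≠ 0)
  have hrt : (r : WithTop ℕ∞) ≠ (⊤ : ℕ∞) := by exact_mod_cast ENat.natCast_ne_top r
  set L := fderiv ℝ h x₀ with hL
  obtain ⟨q, hq⟩ := L.ker_closedComplemented_of_finiteDimensional_range
  have hqs : q.range = ⊤ := LinearMap.range_eq_top.2 fun y => ⟨y, hq y⟩
  have hcompl : IsCompl L.ker q.ker := LinearMap.isCompl_of_proj hq
  let e := L.equivProdOfSurjectiveOfIsCompl q hsurj hqs hcompl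
  let F : E → R × L.ker := fun x => (h x, q x)
  have hF : ContDiffAt ℝ r F x₀ := hh.prodMk q.contDiff.contDiffAt
  have hF' : HasFDerivAt F (e : E →L[ℝ] R × L.ker) x₀ := by
    have := (hh.differentiableAt hr0).hasFDerivAt.prodMk q.hasFDerivAt (x := x₀)
    exact this
  let Φ₀ := hF.toOpenPartialHomeomorph F hF' hr0
  have hΦ₀ : ∀ x, Φ₀ x = F x := fun x => rfl
  have hx₀ : x₀ ∈ Φ₀.source := hF.mem_toOpenPartialHomeomorph_source hF' hr0
  have hsymm : ContDiffAt ℝ r Φ₀.symm (Φ₀ x₀) := hF.to_localInverse hF' hr0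
  have h1 : {x | ContDiffAt ℝ r h x} ∈ 𝓝 x₀ := hh.eventually hrt
  have h2 : {y | ContDiffAt ℝ r Φ₀.symm y} ∈ 𝓝 (Φ₀ x₀) := hsymm.eventually hrt
  have h3 : Φ₀ ⁻¹' {y | ContDiffAt ℝ r Φ₀.symm y} ∈ 𝓝 x₀ := (Φ₀.continuousAt hx₀) h2
  -- The inverse function theorem gives regularity at `x₀` only; it persists nearby because `r` is
  -- finite, and the chart is shrunk accordingly.
  obtain ⟨U, hU, hUo, hxU⟩ := mem_nhds_iff.1 (Filter.inter_mem h1 h3)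
  refine ⟨L.ker, by simpa using e.toLinearEquiv.finrank_eq.symm, Φ₀.restrOpen U hUo, ⟨hx₀, hxU⟩, fun x _ => rfl, fun x hx => (hU hx.2).1, ?_⟩
  intro y hy
  have hy' := (Φ₀.restrOpen U hUo).map_target hy
  have := (hU hy'.2).2
  have h4 : Φ₀ ((Φ₀.restrOpen U hUo).symm y) = y := (Φ₀.restrOpen U hUo).right_inv hy
  simp only [Set.mem_preimage, h4] at this
  exact this

/-- If `D f ∘ ψ` is flat of order `s` at `y`, then `f ∘ ψ - f (ψ y)` is flat of order `s + 1`. -/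
theorem isBigO_comp_sub_of_isBigO_fderiv {V E F : Type*}
    [NormedAddCommGroup V] [NormedSpace ℝ V] [NormedAddCommGroup E] [NormedSpace ℝ E]
    [NormedAddCommGroup F] [NormedSpace ℝ F] {s : ℕ} {ψ : V → E} {f : E → F} {y : V}
    (hψ : ContDiffAt ℝ 1 ψ y) (hf : ContDiffAt ℝ 1 f (ψ y))
    (h : (fun z => fderiv ℝ f (ψ z)) =O[𝓝 y] fun z => ‖z - y‖ ^ s) :
    (fun z => f (ψ z) - f (ψ y)) =O[𝓝 y] fun z => ‖z - y‖ ^ (s + 1) := by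
  have h1 : ∀ᶠ z in 𝓝 y, ContDiffAt ℝ 1 ψ z := hψ.eventually (by simp)
  have h2 : ∀ᶠ z in 𝓝 y, ContDiffAt ℝ 1 f (ψ z) :=
    hψ.continuousAt.eventually (hf.eventually (by simp))
  have h3 : (fun z => fderiv ℝ ψ z) =O[𝓝 y] fun _ => (1 : ℝ) :=
    (hψ.fderiv_right (m := 0) (by simp)).continuousAt.isBigO_one ℝ
  obtain ⟨C, hC⟩ := h.bound
  obtain ⟨M, hM⟩ := h3.bound
  obtain ⟨ε, hε, hb⟩ := Metric.eventually_nhds_iff_ball.1 (h1.and (h2.and (hC.and hM)))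
  refine Asymptotics.IsBigO.of_bound (|C| * |M|) ?_
  filter_upwards [Metric.ball_mem_nhds y hε] with z hz
  have hsub : Metric.closedBall y ‖z - y‖ ⊆ Metric.ball y ε := by
    refine Metric.closedBall_subset_ball ?_
    simpa [dist_eq_norm] using hz
  -- On the ball of radius `‖z - y‖` around `y` the derivative is of size `‖z - y‖ ^ s`; the mean
  -- value inequality supplies the additional power.
  have key := (convex_closedBall y ‖z - y‖).norm_image_sub_le_of_norm_hasFDerivWithin_le
    (f := fun w => f (ψ w)) (f' := fun w => (fderiv ℝ f (ψ w)).comp (fderiv ℝ ψ w))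
    (C := |C| * |M| * ‖z - y‖ ^ s) (x := y) (y := z) (fun w hw => ?_) (fun w hw => ?_)
    (Metric.mem_closedBall_self (norm_nonneg _)) (by simp [dist_eq_norm])
  · simpa [pow_succ, mul_assoc, abs_of_nonneg] using key
  · obtain ⟨a, b, -⟩ := hb w (hsub hw)
    exact ((b.differentiableAt one_ne_zero).hasFDerivAt.comp w
      (a.differentiableAt one_ne_zero).hasFDerivAt).hasFDerivWithinAt
  · obtain ⟨-, -, c, d⟩ := hb w (hsub hw)
    have hw' : ‖w - y‖ ≤ ‖z - y‖ := by simpa [dist_eq_norm] using hw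
    refine (ContinuousLinearMap.opNorm_comp_le _ _).trans ?_
    have c' : ‖fderiv ℝ f (ψ w)‖ ≤ |C| * ‖z - y‖ ^ s := by
      refine c.trans ?_
      rw [norm_pow, norm_norm]
      gcongr
      exact le_abs_self C
    have d' : ‖fderiv ℝ ψ w‖ ≤ |M| := by
      refine d.trans ?_
      simpa using le_abs_self M
    calc _ ≤ (|C| * ‖z - y‖ ^ s) * |M| := by gcongr
      _ = _ := by ring

/-! ### Morse's decomposition into flat pieces -/

/-- `D` is covered by a `C^1` image on which every `C^s` function vanishing on `A` is flat of
order `s`. -/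
def FlatPiece {E : Type} [NormedAddCommGroup E] [NormedSpace ℝ E] (s : ℕ) (A D : Set E) : Prop :=
  ∃ p ≤ Module.finrank ℝ E, ∃ (ψ : EuclideanSpace ℝ (Fin p) → E) (B : Set (EuclideanSpace ℝ (Fin p))),
    D ⊆ ψ '' B ∧ (∀ y ∈ B, ψ y ∈ A) ∧ (∀ y ∈ B, ContDiffAt ℝ 1 ψ y) ∧
    ∀ f : E → ℝ, (∀ x ∈ A, ContDiffAt ℝ s f x) → (∀ x ∈ A, f x = 0) →
      ∀ y ∈ B, (fun z => f (ψ z)) =O[𝓝 y] fun z => ‖z - y‖ ^ s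

/-- `D` is a countable union of flat pieces. -/
def CountablyFlat {E : Type} [NormedAddCommGroup E] [NormedSpace ℝ E] (s : ℕ) (A D : Set E) : Prop :=
  ∃ 𝒟 : Set (Set E), 𝒟.Countable ∧ D ⊆ ⋃₀ 𝒟 ∧ ∀ D' ∈ 𝒟, FlatPiece s A D'

section Flat

variable {E : Type} [NormedAddCommGroup E] [NormedSpace ℝ E] {s : ℕ} {A : Set E}

theorem CountablyFlat.mono {D D' : Set E} (h : D ⊆ D') (hD : CountablyFlat s A D') :
    CountablyFlat s A D := by
  obtain ⟨𝒟, h1, h2, h3⟩ := hD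
  exact ⟨𝒟, h1, h.trans h2, h3⟩

theorem CountablyFlat.sUnion {S : Set (Set E)} (hS : S.Countable)
    (h : ∀ D ∈ S, CountablyFlat s A D) : CountablyFlat s A (⋃₀ S) := by
  choose! 𝒟 h1 h2 h3 using h
  refine ⟨⋃ D ∈ S, 𝒟 D, hS.biUnion h1, ?_, ?_⟩
  · rintro x ⟨D, hD, hx⟩
    obtain ⟨D', hD', hx'⟩ := h2 D hD hx
    exact ⟨D', Set.mem_biUnion hD hD', hx'⟩
  · intro D' hD'
    obtain ⟨D, hD, hDD⟩ := Set.mem_iUnion₂.1 hD'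
    exact h3 D hD D' hDD

/-- Flatness may be tested in coordinates. The vector-valued form is what applies to derivatives of
functions. -/
theorem FlatPiece.exists_vector {D : Set E} (h : FlatPiece s A D) :
    ∃ p ≤ Module.finrank ℝ E,
    ∃ (ψ : EuclideanSpace ℝ (Fin p) → E) (B : Set (EuclideanSpace ℝ (Fin p))),
    D ⊆ ψ '' B ∧ (∀ y ∈ B, ψ y ∈ A) ∧ (∀ y ∈ B, ContDiffAt ℝ 1 ψ y) ∧
    ∀ (F : Type) [NormedAddCommGroup F] [NormedSpace ℝ F] [FiniteDimensional ℝ F] (f : E → F),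
      (∀ x ∈ A, ContDiffAt ℝ s f x) → (∀ x ∈ A, f x = 0) →
      ∀ y ∈ B, (fun z => f (ψ z)) =O[𝓝 y] fun z => ‖z - y‖ ^ s := by
  obtain ⟨p, hp, ψ, B, h1, h2, h3, h4⟩ := h
  refine ⟨p, hp, ψ, B, h1, h2, h3, fun F _ _ _ f hf hf0 y hy => ?_⟩
  let e := (Module.finBasis ℝ F).equivFunL
  have hO : (fun z => e (f (ψ z))) =O[𝓝 y] fun z => ‖z - y‖ ^ s := by
    refine Asymptotics.isBigO_pi.2 fun i => ?_
    refine h4 (fun x => e (f x) i) (fun x hx => ?_) (fun x hx => by simp [hf0 x hx]) y hy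
    exact contDiffAt_pi.1 (e.contDiff.contDiffAt.comp x (hf x hx)) i
  refine (ContinuousLinearMap.isBigO_comp (e.symm : _ →L[ℝ] F) (fun z => e (f (ψ z))) _ |>.trans hO).congr_left ?_
  intro z
  simp

end Flat

theorem countablyFlat_zero {E : Type} [NormedAddCommGroup E] [NormedSpace ℝ E]
    [FiniteDimensional ℝ E] (A : Set E) : CountablyFlat 0 A A := by
  refine ⟨{A}, Set.countable_singleton _, by simp, ?_⟩
  intro D hD
  rw [Set.mem_singleton_iff.1 hD]
  let e : E ≃L[ℝ] EuclideanSpace ℝ (Fin (Module.finrank ℝ E)) := toEuclidean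
  refine ⟨_, le_rfl, e.symm, e.symm ⁻¹' A, ?_, fun y hy => hy, fun y _ => e.symm.contDiff.contDiffAt, ?_⟩
  · intro x hx
    exact ⟨e x, by simpa using hx, by simp⟩
  · intro f hf _ y hy
    have : ContinuousAt (fun z => f (e.symm z)) y :=
      (hf _ hy).continuousAt.comp e.symm.continuous.continuousAt
    simpa using this.isBigO_one ℝ

/-- Double induction, on the order `s` and on the dimension. Where all admissible functions
vanishing on `A` also have zero derivative, the derivatives are flat of order `s` and integration
gains one order. Elsewhere `A` lies locally in a regular hypersurface, and the dimension drops. -/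
theorem countablyFlat_self (s : ℕ) : ∀ (n : ℕ) (E : Type) [NormedAddCommGroup E] [NormedSpace ℝ E]
    [FiniteDimensional ℝ E] (A : Set E), Module.finrank ℝ E = n → CountablyFlat s A A := by
  induction s with
  | zero => exact fun n E _ _ _ A _ => countablyFlat_zero A
  | succ s ihs =>
  intro n
  induction n using Nat.strong_induction_on with
  | _ n ihn =>
  intro E _ _ _ A hn
  let A' : Set E := {x ∈ A | ∀ f : E → ℝ, (∀ x ∈ A, ContDiffAt ℝ (s + 1 : ℕ) f x) →
    (∀ x ∈ A, f x = 0) → fderiv ℝ f x = 0}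
  have hA' : CountablyFlat (s + 1) A A' := by
    obtain ⟨𝒟, hc, hsub, hp⟩ := ihs n E A' hn
    refine ⟨𝒟, hc, hsub, fun D hD => ?_⟩
    obtain ⟨p, hp, ψ, B, h1, h2, h3, h4⟩ := (hp D hD).exists_vector
    refine ⟨p, hp, ψ, B, h1, fun y hy => (h2 y hy).1, h3, fun f hf hf0 y hy => ?_⟩
    have h5 := h4 (E →L[ℝ] ℝ) (fderiv ℝ f)
      (fun x hx => (hf x hx.1).fderiv_right (by push_cast; exact le_rfl))
      (fun x hx => hx.2 f hf hf0) y hy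
    have h6 := isBigO_comp_sub_of_isBigO_fderiv (h3 y hy)
      ((hf _ (h2 y hy).1).of_le (by push_cast; exact le_add_self)) h5
    simpa [hf0 _ (h2 y hy).1] using h6
  have hA'' : CountablyFlat (s + 1) A (A \ A') := by
    -- The Lindelöf property reduces a countable decomposition to a local one.
    refine (HereditarilyLindelofSpace.isLindelof (A \ A')).induction_on
      (fun _ _ h => CountablyFlat.mono h) (fun _ hS => CountablyFlat.sUnion hS) ?_
    rintro x ⟨hxA, hxA'⟩
    have : ∃ f : E → ℝ, (∀ x ∈ A, ContDiffAt ℝ (s + 1 : ℕ) f x) ∧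
        (∀ x ∈ A, f x = 0) ∧ fderiv ℝ f x ≠ 0 := by
      by_contra! hcon
      exact hxA' ⟨hxA, hcon⟩
    obtain ⟨f, hf, hf0, hfx⟩ := this
    have hsurj : LinearMap.range (fderiv ℝ f x).toLinearMap = ⊤ := by
      refine LinearMap.range_eq_top.2 (LinearMap.surjective ?_)
      intro h0
      exact hfx (ContinuousLinearMap.coe_injective h0)
    obtain ⟨K, hK, Φ, hxs, hΦ1, hΦ2, hΦ3⟩ :=
      (hf x hxA).exists_openPartialHomeomorph_fst (by omega) hsurj
    have hdim : Module.finrank ℝ K < n := by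
      rw [Module.finrank_self] at hK
      omega
    -- Since `f` is the first coordinate of the chart and vanishes on `A`, the slice `{0} × K`
    -- parametrises `A` near `x`.
    let φ : K → E := fun y => Φ.symm (0, y)
    let B₀ : Set K := {y | ((0 : ℝ), y) ∈ Φ.target ∧ φ y ∈ A}
    have hφ : ∀ y ∈ B₀, ContDiffAt ℝ (s + 1 : ℕ) φ y := fun y hy =>
      (hΦ3 (0, y) hy.1).comp (f := fun y : K => ((0 : ℝ), y)) y
        (contDiffAt_const.prodMk contDiffAt_id)
    obtain ⟨𝒟, hc, hsub, hp⟩ := ihn _ hdim K B₀ rfl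
    refine ⟨Φ.source ∩ A, Filter.inter_mem (mem_nhdsWithin_of_mem_nhds (Φ.open_source.mem_nhds hxs))
      (mem_of_superset self_mem_nhdsWithin Set.sdiff_subset), (fun D => φ '' D) '' 𝒟, hc.image _, ?_, ?_⟩
    · rintro z ⟨hzs, hzA⟩
      have hz1 : Φ z = (0, (Φ z).2) := Prod.ext (by rw [hΦ1 z hzs, hf0 z hzA]) rfl
      have hz2 : φ (Φ z).2 = z := by
        change Φ.symm (0, (Φ z).2) = z
        rw [← hz1, Φ.left_inv hzs]
      have hzB : (Φ z).2 ∈ B₀ := ⟨by rw [← hz1]; exact Φ.map_source hzs, by rw [hz2]; exact hzA⟩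
      obtain ⟨D, hD, hzD⟩ := hsub hzB
      exact ⟨φ '' D, ⟨D, hD, rfl⟩, _, hzD, hz2⟩
    · rintro _ ⟨D, hD, rfl⟩
      obtain ⟨p, hp, ψ, B, h1, h2, h3, h4⟩ := hp D hD
      refine ⟨p, by omega, φ ∘ ψ, B, ?_, fun y hy => (h2 y hy).2, fun y hy => ?_,
        fun g hg hg0 y hy => ?_⟩
      · rw [Set.image_comp]
        exact Set.image_mono h1
      · exact ((hφ _ (h2 y hy)).of_le (by push_cast; exact le_add_self)).comp y (h3 y hy)
      · exact h4 (g ∘ φ) (fun z hz => (hg _ hz.2).comp z (hφ z hz)) (fun z hz => hg0 _ hz.2) y hy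
  have := CountablyFlat.sUnion (s := s + 1) (A := A) (S := {A', A \ A'})
    ((Set.countable_singleton _).insert _) (by rintro D (rfl | rfl) <;> assumption)
  refine this.mono ?_
  intro x hx
  by_cases h : x ∈ A'
  · exact ⟨A', by simp, h⟩
  · exact ⟨A \ A', by simp, hx, h⟩

/-! ### Critical values of rank zero -/

/-- The set of critical values of rank zero of a `C^r` map has Hausdorff dimension at most
`dim E / r`. -/
theorem dimH_image_le_of_fderiv_eq_zero {E F : Type} [NormedAddCommGroup E] [NormedSpace ℝ E]
    [FiniteDimensional ℝ E] [NormedAddCommGroup F] [NormedSpace ℝ F] [FiniteDimensional ℝ F]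
    {r : ℕ} (hr : 1 ≤ r) {g : E → F} {A : Set E} (hg : ∀ x ∈ A, ContDiffAt ℝ r g x)
    (hg0 : ∀ x ∈ A, fderiv ℝ g x = 0) :
    dimH (g '' A) ≤ Module.finrank ℝ E / r := by
  obtain ⟨s, rfl⟩ : ∃ s, r = s + 1 := ⟨r - 1, by omega⟩
  obtain ⟨𝒟, hc, hsub, hp⟩ := countablyFlat_self s _ E A rfl
  have h𝒟 : ∀ D ∈ 𝒟, dimH (g '' D) ≤ Module.finrank ℝ E / (s + 1 : ℕ) := by
    intro D hD
    obtain ⟨p, hp, ψ, B, h1, h2, h3, h4⟩ := (hp D hD).exists_vector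
    -- One integer `n` bounds both the implied constant and the inverse radius, so that the Hölder
    -- estimate of exponent `s + 1` is uniform on each `Bn n`.
    let Bn : ℕ → Set (EuclideanSpace ℝ (Fin p)) := fun n =>
      {y ∈ B | ∀ z, ‖z - y‖ * (n + 1) < 1 → ‖g (ψ z) - g (ψ y)‖ ≤ n * ‖z - y‖ ^ (s + 1)}
    have hB : B ⊆ ⋃ n, Bn n := by
      intro y hy
      have h5 := isBigO_comp_sub_of_isBigO_fderiv (h3 y hy)
        ((hg _ (h2 y hy)).of_le (by push_cast; exact le_add_self))
        (h4 _ (fderiv ℝ g) (fun x hx => (hg x hx).fderiv_right (by push_cast; exact le_rfl)) hg0 y hy)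
      obtain ⟨C, hC⟩ := h5.bound
      obtain ⟨ε, hε, hb⟩ := Metric.eventually_nhds_iff_ball.1 hC
      obtain ⟨n, hn⟩ := exists_nat_ge (max C (1 / ε))
      refine Set.mem_iUnion.2 ⟨n, hy, fun z hz => ?_⟩
      have hnpos : (0 : ℝ) < n + 1 := by positivity
      have hz' : z ∈ Metric.ball y ε := by
        rw [Metric.mem_ball, dist_eq_norm]
        have h6 : 1 / ε ≤ n := (le_max_right _ _).trans hn
        rw [div_le_iff₀ hε] at h6
        nlinarith
      refine (hb z hz').trans ?_
      rw [norm_pow, norm_norm]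
      gcongr
      exact (le_max_left _ _).trans hn
    have hsub' : g '' D ⊆ ⋃ n, (g ∘ ψ) '' Bn n := by
      rw [← Set.image_iUnion, Set.image_comp]
      exact Set.image_mono (h1.trans (Set.image_mono hB))
    refine (dimH_mono hsub').trans ?_
    rw [dimH_iUnion]
    refine iSup_le fun n => ?_
    have hpos : (0 : NNReal) < ((s + 1 : ℕ) : NNReal) := by positivity
    refine (dimH_image_le_of_locally_holder_on (r := ((s + 1 : ℕ) : NNReal)) hpos ?_).trans ?_
    · intro y hy
      refine ⟨n, Metric.ball y (1 / (2 * (n + 1))) ∩ Bn n,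
        Filter.inter_mem (mem_nhdsWithin_of_mem_nhds (Metric.ball_mem_nhds y (by positivity)))
          self_mem_nhdsWithin, ?_⟩
      intro z hz w hw
      have hzw : dist w z < 1 / (n + 1) := by
        have h5 := Metric.mem_ball.1 hz.1
        have h6 := Metric.mem_ball.1 hw.1
        have h7 := dist_triangle_right w z y
        have h8 : (1 : ℝ) / (n + 1) = 1 / (2 * (n + 1)) + 1 / (2 * (n + 1)) := by
          field_simp
          norm_num
        linarith
      have h9 := hz.2.2 w (by
        rw [← dist_eq_norm]
        exact (lt_div_iff₀ (by positivity)).1 hzw)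
      rw [← dist_eq_norm, ← dist_eq_norm] at h9
      rw [edist_comm, edist_comm z w, edist_dist, edist_dist]
      refine (ENNReal.ofReal_le_ofReal h9).trans (le_of_eq ?_)
      rw [ENNReal.ofReal_mul (by positivity), ENNReal.ofReal_natCast, ENNReal.ofReal_pow dist_nonneg,
        NNReal.coe_natCast, ENNReal.rpow_natCast, ENNReal.coe_natCast]
    · have : dimH (Bn n) ≤ Module.finrank ℝ E := by
        refine (dimH_mono (Set.subset_univ _)).trans ?_
        rw [Real.dimH_univ_eq_finrank, finrank_euclideanSpace_fin]
        exact_mod_cast hp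
      push_cast
      gcongr
  calc dimH (g '' A) ≤ dimH (⋃ D ∈ 𝒟, g '' D) := by
        refine dimH_mono ?_
        rw [← Set.image_iUnion₂, ← Set.sUnion_eq_biUnion]
        exact Set.image_mono hsub
    _ ≤ _ := by
        rw [dimH_bUnion hc]
        exact iSup₂_le h𝒟

theorem measure_eq_zero_of_dimH_lt_finrank {F : Type*} [NormedAddCommGroup F] [NormedSpace ℝ F]
    [FiniteDimensional ℝ F] [MeasurableSpace F] [BorelSpace F] (μ : Measure F) [μ.IsAddHaarMeasure]
    {s : Set F} (hs : dimH s < Module.finrank ℝ F) : μ s = 0 := by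
  let e : F ≃L[ℝ] (Fin (Module.finrank ℝ F) → ℝ) := (Module.finBasis ℝ F).equivFunL
  have h1 : dimH (e '' s) < (Module.finrank ℝ F : NNReal) := by
    rw [e.dimH_image]
    exact_mod_cast hs
  have h2 := hausdorffMeasure_of_dimH_lt h1
  have h3 : (volume : Measure (Fin (Module.finrank ℝ F) → ℝ)) (e '' s) = 0 := by
    rw [← hausdorffMeasure_pi_real]
    simpa using h2
  have h4 : (μ.map e).IsAddHaarMeasure := e.isAddHaarMeasure_map μ
  have h5 : (μ.map e) (e '' s) = 0 := Measure.absolutelyContinuous_isAddHaarMeasure _ volume h3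
  -- This inequality holds for arbitrary sets, so `s` need not be measurable.
  have h6 := Measure.le_map_apply (μ := μ) e.continuous.aemeasurable (e '' s)
  rw [e.injective.preimage_image, h5] at h6
  exact le_antisymm h6 bot_le

/-! ### Sard's theorem -/

theorem IsOpen.isSigmaCompact_inter_isClosed {X : Type*} [MetricSpace X] [SigmaCompactSpace X]
    {V u : Set X} (hV : IsOpen V) (hu : IsClosed u) : IsSigmaCompact (u ∩ V) := by
  obtain ⟨K, hK, -, hKV, -⟩ := hV.exists_iUnion_isClosed
  rw [← hKV, Set.inter_iUnion]
  exact isSigmaCompact_iUnion _ fun n => isSigmaCompact_univ.of_isClosed_subset (hu.inter (hK n)) (Set.subset_univ _)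

/-- Sard's theorem for the critical points of `(x, y) ↦ (x, G (x, y))` of lowest possible rank. -/
theorem measure_graph_critical_eq_zero {X Y Z : Type}
    [NormedAddCommGroup X] [NormedSpace ℝ X] [FiniteDimensional ℝ X] [MeasurableSpace X] [BorelSpace X]
    [NormedAddCommGroup Y] [NormedSpace ℝ Y] [FiniteDimensional ℝ Y]
    [NormedAddCommGroup Z] [NormedSpace ℝ Z] [FiniteDimensional ℝ Z] [MeasurableSpace Z] [BorelSpace Z]
    (μ : Measure X) [SFinite μ] (ν : Measure Z) [ν.IsAddHaarMeasure] {r : ℕ} (hr : 1 ≤ r)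
    (hdim : Module.finrank ℝ Y < r * Module.finrank ℝ Z)
    {G : X × Y → Z} {V : Set (X × Y)} (hV : IsOpen V) (hG : ∀ v ∈ V, ContDiffAt ℝ r G v) :
    (μ.prod ν) ((fun v => (v.1, G v)) ''
      {v ∈ V | (fderiv ℝ G v).comp (ContinuousLinearMap.inr ℝ X Y) = 0}) = 0 := by
  set B := {v ∈ V | (fderiv ℝ G v).comp (ContinuousLinearMap.inr ℝ X Y) = 0} with hB
  have hr1 : (1 : WithTop ℕ∞) ≤ r := by exact_mod_cast hr
  have hr0 : (r : WithTop ℕ∞) ≠ 0 := by exact_mod_cast (by omega : r ≠ 0)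
  have hc : ContinuousOn (fun v => (fderiv ℝ G v).comp (ContinuousLinearMap.inr ℝ X Y)) V := by
    intro v hv
    have : ContinuousAt (fderiv ℝ G) v := ((hG v hv).fderiv_right (m := 0) (by simpa using hr1)).continuousAt
    exact (this.clm_comp continuousAt_const).continuousWithinAt
  obtain ⟨u, hu, huV⟩ := continuousOn_iff_isClosed.1 hc {0} isClosed_singleton
  have hBu : B = u ∩ V := by
    rw [← huV]
    ext v
    simp [hB, and_comm]
  -- Fubini needs a measurable set; the critical image is even σ-compact.
  have hσ : IsSigmaCompact ((fun v => (v.1, G v)) '' B) := by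
    rw [hBu]
    refine (hV.isSigmaCompact_inter_isClosed hu).image_of_continuousOn ?_
    intro v hv
    exact (continuousAt_fst.prodMk (hG v hv.2).continuousAt).continuousWithinAt
  have hmeas : MeasurableSet ((fun v => (v.1, G v)) '' B) := by
    obtain ⟨K, hK, hKe⟩ := hσ
    rw [← hKe]
    exact MeasurableSet.iUnion fun n => (hK n).measurableSet
  rw [Measure.measure_prod_null hmeas]
  refine Eventually.of_forall fun x => ?_
  have hsub : Prod.mk x ⁻¹' ((fun v => (v.1, G v)) '' B) ⊆
      (fun y => G (x, y)) '' {y | (x, y) ∈ B} := by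
    rintro z ⟨⟨x', y⟩, hv, h⟩
    obtain ⟨rfl, rfl⟩ := Prod.mk.inj h
    exact ⟨y, hv, rfl⟩
  refine measure_mono_null hsub (measure_eq_zero_of_dimH_lt_finrank ν ?_)
  refine (dimH_image_le_of_fderiv_eq_zero hr (A := {y | (x, y) ∈ B}) ?_ ?_).trans_lt ?_
  · intro y hy
    exact (hG (x, y) hy.1).comp (f := fun y => (x, y)) y (contDiffAt_const.prodMk contDiffAt_id)
  · intro y hy
    have h1 : HasFDerivAt (fun y : Y => (x, y)) (ContinuousLinearMap.inr ℝ X Y) y :=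
      hasFDerivAt_prodMk_right x y
    have h2 := ((hG (x, y) hy.1).differentiableAt hr0).hasFDerivAt.comp y h1
    exact h2.fderiv.trans hy.2
  · rw [ENNReal.div_lt_iff (Or.inl (by exact_mod_cast (by omega : r ≠ 0))) (Or.inl (by simp)), mul_comm]
    exact_mod_cast hdim

/-- With the projection of `f` onto the range `R` of its derivative at `x₀` as a coordinate, `f`
becomes `(w, y) ↦ (w, G (w, y))`. Its rank is then `ν = dim R` exactly where the derivative of `G`
along `y` vanishes. The inequality `hdim` says `dim E - ν < r (dim F - ν)`. -/
theorem measure_image_rank_eq_null_nhds {E F : Type} [NormedAddCommGroup E] [NormedSpace ℝ E]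
    [FiniteDimensional ℝ E] [NormedAddCommGroup F] [NormedSpace ℝ F] [FiniteDimensional ℝ F]
    [MeasurableSpace F] [BorelSpace F] (μ : Measure F) [μ.IsAddHaarMeasure]
    {r : ℕ} (hr : 1 ≤ r) {f : E → F} {x₀ : E} (hf : ContDiffAt ℝ r f x₀) {ν : ℕ}
    (hν : Module.finrank ℝ (LinearMap.range (fderiv ℝ f x₀).toLinearMap) = ν)
    (hdim : Module.finrank ℝ E + r * ν < r * Module.finrank ℝ F + ν) :
    ∃ t ∈ 𝓝 x₀, μ (f '' (t ∩ {x |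
      Module.finrank ℝ (LinearMap.range (fderiv ℝ f x).toLinearMap) = ν})) = 0 := by
  have hr0 : (r : WithTop ℕ∞) ≠ 0 := by exact_mod_cast (by omega : r ≠ 0)
  set R := LinearMap.range (fderiv ℝ f x₀).toLinearMap with hR
  obtain ⟨Z, hZ⟩ := Submodule.exists_isCompl R
  let e : F ≃L[ℝ] R × Z := (Submodule.prodEquivOfIsCompl R Z hZ).symm.toContinuousLinearEquiv
  have heR : ∀ w (hw : w ∈ R), (e w).1 = ⟨w, hw⟩ := fun w hw => by
    change ((Submodule.prodEquivOfIsCompl R Z hZ).symm w).1 = _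
    rw [Submodule.prodEquivOfIsCompl_symm_apply_left R Z hZ ⟨w, hw⟩]
  let P : F →L[ℝ] R := (ContinuousLinearMap.fst ℝ R Z).comp (e : F →L[ℝ] R × Z)
  let Q : F →L[ℝ] Z := (ContinuousLinearMap.snd ℝ R Z).comp (e : F →L[ℝ] R × Z)
  have hh : ContDiffAt ℝ r (fun x => P (f x)) x₀ := P.contDiff.contDiffAt.comp x₀ hf
  have hh' : fderiv ℝ (fun x => P (f x)) x₀ = P.comp (fderiv ℝ f x₀) :=
    (P.hasFDerivAt.comp x₀ (hf.differentiableAt hr0).hasFDerivAt).fderiv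
  have hsurj : LinearMap.range (fderiv ℝ (fun x => P (f x)) x₀).toLinearMap = ⊤ := by
    rw [hh']
    refine LinearMap.range_eq_top.2 ?_
    rintro ⟨w, v, rfl⟩
    exact ⟨v, heR _ _⟩
  obtain ⟨K, hK, Φ, hxs, hΦ1, hΦ2, hΦ3⟩ := hh.exists_openPartialHomeomorph_fst hr hsurj
  obtain ⟨U, hU, hUo, hxU⟩ := mem_nhds_iff.1 (hf.eventually (by exact_mod_cast ENat.natCast_ne_top r))
  have hU' : ∀ x ∈ U, ContDiffAt ℝ r f x := fun x hx => hU hx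
  let G : R × K → Z := fun v => Q (f (Φ.symm v))
  let V : Set (R × K) := Φ.target ∩ Φ.symm ⁻¹' U
  have hVo : IsOpen V := Φ.isOpen_inter_preimage_symm hUo
  have hfΦ : ∀ v ∈ V, ContDiffAt ℝ r (fun v => f (Φ.symm v)) v := fun v hv =>
    ContDiffAt.comp (g := f) v (hU' _ hv.2) (hΦ3 v hv.1)
  have hG : ∀ v ∈ V, ContDiffAt ℝ r G v := fun v hv =>
    Q.contDiff.contDiffAt.comp v (hfΦ v hv)
  have hfr : Module.finrank ℝ R + Module.finrank ℝ Z = Module.finrank ℝ F :=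
    Submodule.finrank_add_eq_of_isCompl hZ
  have hdim' : Module.finrank ℝ K < r * Module.finrank ℝ Z := by
    rw [← hfr, mul_add, hν] at hdim
    omega
  have hnull := measure_graph_critical_eq_zero (Measure.addHaar : Measure R)
    (Measure.addHaar : Measure Z) hr hdim' hVo hG
  refine ⟨Φ.source ∩ U, Filter.inter_mem (Φ.open_source.mem_nhds hxs) (hUo.mem_nhds hxU), ?_⟩
  have : (μ.map e).IsAddHaarMeasure := e.isAddHaarMeasure_map μ
  have hnull' := Measure.absolutelyContinuous_isAddHaarMeasure (μ.map e)
    ((Measure.addHaar : Measure R).prod (Measure.addHaar : Measure Z)) hnull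
  have h6 := Measure.le_map_apply (μ := μ) (f := e) e.continuous.aemeasurable ((fun v => (v.1, G v)) ''
      {v ∈ V | (fderiv ℝ G v).comp (ContinuousLinearMap.inr ℝ R K) = 0})
  rw [hnull'] at h6
  refine measure_mono_null ?_ (le_antisymm h6 bot_le)
  rintro _ ⟨x, ⟨⟨hxs', hxU'⟩, hxν⟩, rfl⟩
  have hinv : Φ.symm (Φ x) = x := Φ.left_inv hxs'
  have hΦx : Φ x ∈ V := ⟨Φ.map_source hxs', by rw [Set.mem_preimage, hinv]; exact hxU'⟩
  refine ⟨Φ x, ⟨hΦx, ?_⟩, ?_⟩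
  · set D := fderiv ℝ (fun v => f (Φ.symm v)) (Φ x) with hD
    have hDd : HasFDerivAt (fun v => f (Φ.symm v)) D (Φ x) :=
      ((hfΦ _ hΦx).differentiableAt hr0).hasFDerivAt
    have hfx : HasFDerivAt f (fderiv ℝ f x) (Φ.symm (Φ x)) := by
      rw [hinv]
      exact ((hU' _ hxU').differentiableAt hr0).hasFDerivAt
    have hDf : D = (fderiv ℝ f x).comp (fderiv ℝ Φ.symm (Φ x)) :=
      (hfx.comp (Φ x) ((hΦ3 _ hΦx.1).differentiableAt hr0).hasFDerivAt).fderiv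
    have hDG : fderiv ℝ G (Φ x) = Q.comp D := (Q.hasFDerivAt.comp (Φ x) hDd).fderiv
    have hPD : P.comp D = ContinuousLinearMap.fst ℝ R K := by
      refine (P.hasFDerivAt.comp (Φ x) hDd).unique ?_
      refine (ContinuousLinearMap.fst ℝ R K).hasFDerivAt.congr_of_eventuallyEq ?_
      filter_upwards [hVo.mem_nhds hΦx] with v hv
      have h1 := hΦ1 _ (Φ.map_target hv.1)
      rw [Φ.right_inv hv.1] at h1
      exact h1.symm
    -- `P` maps the range of the derivative at `x` onto `R`. Both have dimension `ν`, so `P` is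
    -- injective there and kills no nonzero derivative along `K`.
    have hsurjP : Function.Surjective
        (P.toLinearMap.domRestrict (LinearMap.range (fderiv ℝ f x).toLinearMap)) := by
      intro w
      refine ⟨⟨D (w, 0), ?_⟩, ?_⟩
      · rw [hDf]
        exact ⟨_, rfl⟩
      · exact congrArg (fun T : R × K →L[ℝ] R => T (w, 0)) hPD
    have hinjP := (LinearMap.injective_iff_surjective_of_finrank_eq_finrank (hxν.trans hν.symm)).2 hsurjP
    have hD0 : ∀ k : K, D (0, k) = 0 := by
      intro k
      have hmem : D (0, k) ∈ LinearMap.range (fderiv ℝ f x).toLinearMap := by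
        rw [hDf]
        exact ⟨_, rfl⟩
      have h1 : (⟨D (0, k), hmem⟩ : LinearMap.range (fderiv ℝ f x).toLinearMap) = 0 := by
        refine hinjP ?_
        rw [map_zero]
        exact congrArg (fun T : R × K →L[ℝ] R => T (0, k)) hPD
      exact congrArg Subtype.val h1
    ext1 k
    simp [hDG, hD0]
  · refine Prod.ext (hΦ1 x hxs') ?_
    change Q (f (Φ.symm (Φ x))) = _
    rw [hinv]
    rfl

/-- Sard's theorem, with one order of differentiability more than necessary. -/
theorem measure_image_critical_eq_zero {E F : Type} [NormedAddCommGroup E] [NormedSpace ℝ E]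
    [FiniteDimensional ℝ E] [NormedAddCommGroup F] [NormedSpace ℝ F] [FiniteDimensional ℝ F]
    [MeasurableSpace F] [BorelSpace F] (μ : Measure F) [μ.IsAddHaarMeasure]
    {r : ℕ} (hr : 1 ≤ r) (hdim : Module.finrank ℝ E + 2 ≤ r + Module.finrank ℝ F)
    {f : E → F} {A : Set E} (hf : ∀ x ∈ A, ContDiffAt ℝ r f x)
    (hA : ∀ x ∈ A, Module.finrank ℝ (LinearMap.range (fderiv ℝ f x).toLinearMap) <
      Module.finrank ℝ F) : μ (f '' A) = 0 := by
  have hAν : ∀ ν < Module.finrank ℝ F, μ (f '' (A ∩ {x |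
      Module.finrank ℝ (LinearMap.range (fderiv ℝ f x).toLinearMap) = ν})) = 0 := by
    intro ν hν
    refine (HereditarilyLindelofSpace.isLindelof (A ∩ {x |
      Module.finrank ℝ (LinearMap.range (fderiv ℝ f x).toLinearMap) = ν})).induction_on
      (p := fun D => μ (f '' D) = 0)
      (fun s t hst h => measure_mono_null (Set.image_mono hst) h) ?_ ?_
    · intro S hS h
      rw [Set.sUnion_eq_biUnion, Set.image_iUnion₂]
      exact (measure_biUnion_null_iff hS).2 h
    · rintro x ⟨hxA, hx⟩
      have hνE : ν ≤ Module.finrank ℝ E := by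
        rw [← hx]
        exact LinearMap.finrank_range_le _
      obtain ⟨t, ht, h⟩ := measure_image_rank_eq_null_nhds μ hr (hf x hxA) hx (by
        obtain ⟨p, hp⟩ := Nat.exists_eq_add_of_le hνE
        obtain ⟨q, hq⟩ := Nat.exists_eq_add_of_lt hν
        rw [hp, hq] at hdim ⊢
        -- Here `p = dim E - ν` and `q + 1 = dim F - ν`; the case `ν = 0` is not the only one to be
        -- covered, so the bound is needed for all `q`.
        have : p < r * (q + 1) := by
          rcases lt_or_ge p (q + 1) with h | h
          · nlinarith
          · obtain ⟨c, rfl⟩ := Nat.exists_eq_add_of_le h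
            have : c + 2 ≤ r := by omega
            calc q + 1 + c < (c + 2) * (q + 1) := by nlinarith [Nat.zero_le (c * q)]
              _ ≤ _ := Nat.mul_le_mul_right _ this
        nlinarith)
      exact ⟨_, Filter.inter_mem (mem_nhdsWithin_of_mem_nhds ht)
        (mem_of_superset self_mem_nhdsWithin Set.inter_subset_right), h⟩
  have hsub : f '' A ⊆ ⋃ ν ∈ Set.Iio (Module.finrank ℝ F), f '' (A ∩ {x |
      Module.finrank ℝ (LinearMap.range (fderiv ℝ f x).toLinearMap) = ν}) := by
    rintro _ ⟨x, hx, rfl⟩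
    exact Set.mem_biUnion (hA x hx) ⟨x, ⟨hx, rfl⟩, rfl⟩
  exact measure_mono_null hsub ((measure_biUnion_null_iff (Set.to_countable _)).2 hAν)

/-! ### Volume of the moment cone -/

namespace MixtureMoment

/-- The values of linearly independent functions contain a basis of `ℝ^m`. -/
theorem exists_linearIndependent_values {α : Type*} {m : ℕ} {b : Fin m → α → ℝ} {D : Set α}
    (h : LinearIndependent ℝ (fun i => D.domRestrict (b i))) :
    ∃ p : Fin m → α, (∀ j, p j ∈ D) ∧ LinearIndependent ℝ (fun j i => b i (p j)) := by
  let t : α → Fin m → ℝ := fun x i => b i x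
  have hspan : Submodule.span ℝ (t '' D) = ⊤ := by
    -- A functional annihilating all values would be a linear relation among the functions.
    by_contra hne
    obtain ⟨f, hf0, hf⟩ := Submodule.exists_le_ker_of_lt_top _ (lt_top_iff_ne_top.2 hne)
    refine hf0 ?_
    have h1 := Fintype.linearIndependent_iff.1 h (fun i => f (Pi.single i 1)) (by
      ext ⟨x, hx⟩
      have h2 : f (t x) = 0 := hf (Submodule.subset_span ⟨x, hx, rfl⟩)
      rw [← Finset.univ_sum_single (t x), map_sum] at h2
      have h3 : ∀ i, f (Pi.single i (t x i)) = f (Pi.single i 1) * b i x := fun i => by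
        have h4 : (Pi.single i (t x i) : Fin m → ℝ) = b i x • Pi.single i 1 := by
          ext j
          simp [Pi.single_apply, t]
        rw [h4, map_smul, smul_eq_mul, mul_comm]
      simpa [h3, Finset.sum_apply] using h2)
    ext i
    simpa using h1 i
  obtain ⟨v, hv, -, hli⟩ := Submodule.exists_fun_fin_finrank_span_eq ℝ (t '' D)
  have hm : m = Module.finrank ℝ (Submodule.span ℝ (t '' D)) := by
    rw [hspan, finrank_top, Module.finrank_fin_fun]
  choose p hp hpv using hv
  refine ⟨fun j => p (Fin.cast hm j), fun j => hp _, ?_⟩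
  have h1 : (fun (j : Fin m) i => b i (p (Fin.cast hm j))) = v ∘ Fin.cast hm :=
    funext fun j => hpv _
  rw [h1]
  exact hli.comp _ (Fin.cast_injective hm)

variable {E P : Type*} [MeasurableSpace E] {m : ℕ} {X : Set E} {S : Set P}
    {δ : E → P → Measure E} {a : Fin m → E → ℝ}

/-- Positive combinations of a basis of value vectors form a nonempty open subset of the cone. -/
theorem volume_mixtureCone_ne_zero
    (h : LinearIndependent ℝ (fun i => (X ×ˢ S).domRestrict (momentFn X δ a i))) :
    volume (mixtureCone X S δ a) ≠ 0 := by
  obtain ⟨p, hp, hli⟩ := exists_linearIndependent_values h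
  let b := Module.Basis.mk hli (hli.span_eq_top_of_card_eq_finrank' (by simp)).ge
  let e := b.equivFunL.symm
  have hopen : IsOpen (e '' {c | ∀ j, 0 < c j}) := by
    refine e.isOpenMap _ ?_
    rw [Set.ofPred_forall]
    exact isOpen_iInter_of_finite fun j => isOpen_lt continuous_const (continuous_apply j)
  have hne : (e '' {c | ∀ j, 0 < c j}).Nonempty := ⟨_, fun _ => 1, fun _ => one_pos, rfl⟩
  have hsub : e '' {c | ∀ j, 0 < c j} ⊆ mixtureCone X S δ a := by
    rintro _ ⟨c, hc, rfl⟩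
    refine ⟨(c, fun j => (p j).1, fun j => (p j).2),
      ⟨fun j => (hc j).le, fun j => (hp j).1, fun j => (hp j).2⟩, ?_⟩
    ext i
    change _ = b.equivFun.symm c i
    rw [Module.Basis.equivFun_symm_apply]
    simp [b, momentMap]
  exact fun h0 => (hopen.measure_pos volume hne).ne' (measure_mono_null hsub h0)

/-- If `cara < N`, the cone is covered by finitely many null sets, one for each `k < N`. -/
theorem le_cara_of_volume_image_eq_zero
    (h : LinearIndependent ℝ (fun i => (X ×ˢ S).domRestrict (momentFn X δ a i))) {N : ℕ}
    (hN : ∀ k < N, volume (momentMap X δ a k '' {q ∈ momentDomain X S k | ∀ j, 0 < q.1 j}) = 0) :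
    (N : ℕ∞) ≤ cara X S δ a := by
  by_contra! hlt
  refine volume_mixtureCone_ne_zero h (measure_mono_null
    (t := ⋃ k ∈ Set.Iio N, momentMap X δ a k '' {q ∈ momentDomain X S k | ∀ j, 0 < q.1 j}) ?_
    ((measure_biUnion_null_iff (Set.to_countable _)).2 hN))
  intro s hs
  have h1 : caraAt X S δ a s < N := (le_iSup₂ (f := fun s _ => caraAt X S δ a s) s hs).trans_lt hlt
  obtain ⟨k, hk⟩ := iInf_lt_iff.1 h1
  obtain ⟨⟨q, hq, hq0, hqs⟩, hk⟩ := iInf_lt_iff.1 hk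
  exact Set.mem_biUnion (Nat.cast_lt.1 hk) ⟨q, ⟨hq, hq0⟩, hqs⟩

theorem linearIndependent_momentFn_of_approx [TopologicalSpace P]
    (ha : LinearIndependent ℝ (fun i => X.domRestrict (a i)))
    (h : ∃ σ₀ ∈ closure S, ∀ x ∈ X, ∀ i,
        Tendsto (fun σ => ∫ y in X, a i y ∂(δ x σ)) (𝓝[S] σ₀) (𝓝 (a i x))) :
    LinearIndependent ℝ (fun i => (X ×ˢ S).domRestrict (momentFn X δ a i)) := by
  obtain ⟨σ₀, hσ₀, h⟩ := h
  have : (𝓝[S] σ₀).NeBot := mem_closure_iff_nhdsWithin_neBot.1 hσ₀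
  refine Fintype.linearIndependent_iff.2 fun c hc => Fintype.linearIndependent_iff.1 ha c ?_
  ext ⟨x, hx⟩
  have h1 : Tendsto (fun σ => ∑ i, c i * ∫ y in X, a i y ∂(δ x σ)) (𝓝[S] σ₀)
      (𝓝 (∑ i, c i * a i x)) :=
    tendsto_finsetSum _ fun i _ => (h x hx i).const_mul _
  have h2 : Tendsto (fun σ => ∑ i, c i * ∫ y in X, a i y ∂(δ x σ)) (𝓝[S] σ₀) (𝓝 0) := by
    refine tendsto_const_nhds.congr' ?_
    filter_upwards [self_mem_nhdsWithin] with σ hσ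
    have := congrFun hc ⟨(x, σ), hx, hσ⟩
    simpa [Finset.sum_apply, momentFn] using this.symm
  simpa [Finset.sum_apply] using tendsto_nhds_unique h1 h2

end MixtureMoment

/-! ### Bounds through the rank number -/

namespace MixtureMoment

variable {n₁ n₂ m : ℕ} {X : Set (EuclideanSpace ℝ (Fin n₁))} {S : Set (EuclideanSpace ℝ (Fin n₂))}
  {δ : EuclideanSpace ℝ (Fin n₁) → EuclideanSpace ℝ (Fin n₂) → Measure (EuclideanSpace ℝ (Fin n₁))}
  {a : Fin m → EuclideanSpace ℝ (Fin n₁) → ℝ}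

theorem finrank_params (k : ℕ) : Module.finrank ℝ ((Fin k → ℝ) × (Fin k → EuclideanSpace ℝ (Fin n₁)) ×
    (Fin k → EuclideanSpace ℝ (Fin n₂))) = k * (n₁ + n₂ + 1) := by
  simp [Module.finrank_pi_fintype]
  ring

theorem ceil_le_rankNumber :
    ((⌈(m : ℚ) / (n₁ + n₂ + 1)⌉₊ : ℕ) : ℕ∞) ≤ rankNumber X S δ a := by
  refine le_iInf₂ fun k hk => ?_
  obtain ⟨q, -, hq⟩ := hk
  have h1 := LinearMap.finrank_range_le (fderiv ℝ (momentMap X δ a k) q).toLinearMap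
  rw [hq, finrank_params] at h1
  rw [Nat.cast_le, Nat.ceil_le, div_le_iff₀ (by positivity)]
  exact_mod_cast h1

theorem contDiffAt_momentMap (hX : IsOpen X) (hS : IsOpen S) {r : WithTop ℕ∞}
    (h : ∀ i, ContDiffOn ℝ r (momentFn X δ a i) (X ×ˢ S)) {k : ℕ}
    {q : (Fin k → ℝ) × (Fin k → EuclideanSpace ℝ (Fin n₁)) × (Fin k → EuclideanSpace ℝ (Fin n₂))}
    (hq : q ∈ momentDomain X S k) : ContDiffAt ℝ r (momentMap X δ a k) q := by
  refine contDiffAt_pi.2 fun i => ContDiffAt.sum fun j _ => ContDiffAt.mul (by fun_prop) ?_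
  have h1 : ContDiffAt ℝ r (momentFn X δ a i) (q.2.1 j, q.2.2 j) :=
    (h i).contDiffAt ((hX.prod hS).mem_nhds ⟨hq.2.1 j, hq.2.2 j⟩)
  exact h1.comp (f := fun q : (Fin k → ℝ) × (Fin k → EuclideanSpace ℝ (Fin n₁)) ×
    (Fin k → EuclideanSpace ℝ (Fin n₂)) => (q.2.1 j, q.2.2 j)) q (by fun_prop)

theorem rankNumber_le_cara (hX : IsOpen X) (hS : IsOpen S)
    (hli : LinearIndependent ℝ (fun i => (X ×ˢ S).domRestrict (momentFn X δ a i)))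
    {r : ℕ∞} (hr : 1 ≤ r) (h : ∀ i, ContDiffOn ℝ r (momentFn X δ a i) (X ×ˢ S))
    (hN : rankNumber X S δ a * ((n₁ : ℕ∞) + n₂ + 1) < r + m) :
    rankNumber X S δ a ≤ cara X S δ a := by
  cases hNe : rankNumber X S δ a with
  | top =>
    rw [hNe, ENat.top_mul (by simp)] at hN
    exact absurd hN not_top_lt
  | coe N =>
  -- Sard's theorem is applied with a finite order; for `r = ∞` any large enough order will do.
  obtain ⟨r', hr1, hr', hN'⟩ : ∃ r' : ℕ, 1 ≤ r' ∧ (r' : ℕ∞) ≤ r ∧ N * (n₁ + n₂ + 1) < r' + m := by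
    rw [hNe] at hN
    cases r with
    | top => exact ⟨N * (n₁ + n₂ + 1) + 1, by omega, le_top, by omega⟩
    | coe r => exact ⟨r, by exact_mod_cast hr, le_rfl, by exact_mod_cast hN⟩
  refine le_cara_of_volume_image_eq_zero hli fun k hk => ?_
  have hrank : ¬ HasFullRank X S δ a k := fun hk' => by
    have h1 : rankNumber X S δ a ≤ k := iInf₂_le k hk'
    rw [hNe, Nat.cast_le] at h1
    omega
  refine measure_mono_null (Set.image_mono (Set.sep_subset _ _)) ?_
  refine measure_image_critical_eq_zero volume hr1 ?_
    (fun q hq => (contDiffAt_momentMap hX hS h hq).of_le (by exact_mod_cast hr')) fun q hq => ?_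
  · rw [finrank_params, Module.finrank_fin_fun]
    -- As `k < N`, at least one block of `n₁ + n₂ + 1 ≥ 1` parameters is missing, which pays for the
    -- extra order in this form of Sard's theorem.
    have : (k + 1) * (n₁ + n₂ + 1) ≤ N * (n₁ + n₂ + 1) := Nat.mul_le_mul_right _ hk
    rw [add_mul] at this
    omega
  · refine lt_of_le_of_ne (Submodule.finrank_le _) fun h1 => hrank ⟨q, hq, ?_⟩
    rw [h1, Module.finrank_fin_fun]

end MixtureMoment

/-! ### Laplace transforms -/

theorem locallyLipschitzOn_pi {α ι : Type*} [PseudoEMetricSpace α] [Fintype ι] {β : ι → Type*}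
    [∀ i, PseudoEMetricSpace (β i)] {s : Set α} {f : α → ∀ i, β i}
    (hf : ∀ i, LocallyLipschitzOn s fun x => f x i) : LocallyLipschitzOn s f := by
  intro x hx
  choose C t ht hC using fun i => hf i hx
  refine ⟨∑ i, C i, ⋂ i, t i, Filter.iInter_mem.2 ht, fun y hy z hz => edist_pi_le_iff.2 fun i => ?_⟩
  refine (hC i (Set.mem_iInter.1 hy i) (Set.mem_iInter.1 hz i)).trans ?_
  gcongr
  exact Finset.single_le_sum (f := C) (fun _ _ => zero_le) (Finset.mem_univ i)

namespace ExpFamily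

theorem exp_convex {W : Type*} [AddCommGroup W] [Module ℝ W] (ℓ : W →ₗ[ℝ] ℝ) {θ₁ θ₂ : W} {s t : ℝ}
    (hs : 0 ≤ s) (ht : 0 ≤ t) (hst : s + t = 1) :
    Real.exp (ℓ (s • θ₁ + t • θ₂)) ≤ s * Real.exp (ℓ θ₁) + t * Real.exp (ℓ θ₂) := by
  simpa using convexOn_exp.2 (Set.mem_univ (ℓ θ₁)) (Set.mem_univ (ℓ θ₂)) hs ht hst

variable {α W : Type*} [MeasurableSpace α] {μ : Measure α}
  [NormedAddCommGroup W] [NormedSpace ℝ W] {ℓ : α → W →ₗ[ℝ] ℝ} {a : α → ℝ}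

/-- The parameters at which the Laplace transform of `a μ` converges. -/
def domain (μ : Measure α) (ℓ : α → W →ₗ[ℝ] ℝ) (a : α → ℝ) : Set W :=
  {θ | Integrable (fun y => a y * Real.exp (ℓ y θ)) μ}

/-- The Laplace transform of `a μ` along the linear forms `ℓ y`. -/
def laplace (μ : Measure α) (ℓ : α → W →ₗ[ℝ] ℝ) (a : α → ℝ) (θ : W) : ℝ :=
  ∫ y, a y * Real.exp (ℓ y θ) ∂μ

theorem convex_domain (hℓ : ∀ θ, Measurable fun y => ℓ y θ) (ha : Measurable a) :
    Convex ℝ (domain μ ℓ a) := by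
  intro θ₁ h₁ θ₂ h₂ s t hs ht hst
  refine ((h₁.norm.const_mul s).add (h₂.norm.const_mul t)).mono'
    (ha.mul (Real.measurable_exp.comp (hℓ _))).aestronglyMeasurable (Eventually.of_forall fun y => ?_)
  simp only [norm_mul, Real.norm_eq_abs, Real.abs_exp, Pi.add_apply]
  calc _ ≤ |a y| * (s * Real.exp (ℓ y θ₁) + t * Real.exp (ℓ y θ₂)) := by
        gcongr
        exact exp_convex (ℓ y) hs ht hst
    _ = _ := by ring

theorem convexOn_laplace {D : Set W} (hD : Convex ℝ D) (hDa : D ⊆ domain μ ℓ a) (ha : ∀ y, 0 ≤ a y) :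
    ConvexOn ℝ D (laplace μ ℓ a) := by
  refine ⟨hD, fun θ₁ h₁ θ₂ h₂ s t hs ht hst => ?_⟩
  have i1 := (hDa h₁).const_mul s
  have i2 := (hDa h₂).const_mul t
  simp only [laplace, smul_eq_mul]
  rw [← integral_const_mul, ← integral_const_mul, ← integral_add i1 i2]
  refine integral_mono (hDa (hD h₁ h₂ hs ht hst)) (i1.add i2) fun y => ?_
  calc _ ≤ a y * (s * Real.exp (ℓ y θ₁) + t * Real.exp (ℓ y θ₂)) := by
        gcongr
        · exact ha y
        · exact exp_convex (ℓ y) hs ht hst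
    _ = _ := by ring

/-- Splitting `a` into positive and negative parts writes the transform as a difference of convex
functions, which are locally Lipschitz on open sets in finite dimension. -/
theorem locallyLipschitzOn_laplace [FiniteDimensional ℝ W] (hℓ : ∀ θ, Measurable fun y => ℓ y θ)
    (ha : Measurable a) : LocallyLipschitzOn (interior (domain μ ℓ a)) (laplace μ ℓ a) := by
  have hconv : Convex ℝ (interior (domain μ ℓ a)) := (convex_domain hℓ ha).interior
  have hpos : ∀ θ ∈ domain μ ℓ a, Integrable (fun y => max (a y) 0 * Real.exp (ℓ y θ)) μ :=
    fun θ hθ => by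
      refine hθ.pos_part.congr (Eventually.of_forall fun y => ?_)
      simp only [max_mul_of_nonneg _ _ (Real.exp_pos _).le, zero_mul]
  have hneg : ∀ θ ∈ domain μ ℓ a, Integrable (fun y => max (-a y) 0 * Real.exp (ℓ y θ)) μ :=
    fun θ hθ => by
      refine hθ.neg_part.congr (Eventually.of_forall fun y => ?_)
      simp only [max_mul_of_nonneg _ _ (Real.exp_pos _).le, zero_mul, neg_mul]
  have h1 := (convexOn_laplace (a := fun y => max (a y) 0) hconv
    (fun θ hθ => hpos θ (interior_subset hθ)) (fun y => le_max_right _ _)).locallyLipschitzOn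
    isOpen_interior
  have h2 := (convexOn_laplace (a := fun y => max (-a y) 0) hconv
    (fun θ hθ => hneg θ (interior_subset hθ)) (fun y => le_max_right _ _)).locallyLipschitzOn
    isOpen_interior
  have heq : Set.EqOn (laplace μ ℓ a) (fun θ => laplace μ ℓ (fun y => max (a y) 0) θ -
      laplace μ ℓ (fun y => max (-a y) 0) θ) (interior (domain μ ℓ a)) := by
    intro θ hθ
    have h3 := interior_subset hθ
    simp only [laplace]
    rw [← integral_sub (hpos _ h3) (hneg _ h3)]
    refine integral_congr_ae (Eventually.of_forall fun y => ?_)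
    simp only
    rw [← sub_mul]
    congr 1
    rcases le_total 0 (a y) with h | h <;> simp [h]
  intro θ hθ
  obtain ⟨C, t, ht, hC⟩ := h1.sub h2 hθ
  refine ⟨C, t ∩ interior (domain μ ℓ a), Filter.inter_mem ht self_mem_nhdsWithin, ?_⟩
  intro x hx y hy
  rw [heq hx.2, heq hy.2]
  exact hC hx.1 hy.1

/-- Sums of `k` values of the Laplace transforms of `m` functions form a null set if
`k * dim W < m`. -/
theorem volume_sum_laplace_eq_zero [FiniteDimensional ℝ W] (hℓ : ∀ θ, Measurable fun y => ℓ y θ)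
    {m k : ℕ} {a : Fin m → α → ℝ} (ha : ∀ i, Measurable (a i)) (hk : k * Module.finrank ℝ W < m) :
    volume ((fun (θ : Fin k → W) (i : Fin m) => ∑ j, laplace μ ℓ (a i) (θ j)) ''
      {θ | ∀ j i, θ j ∈ interior (domain μ ℓ (a i))}) = 0 := by
  refine measure_eq_zero_of_dimH_lt_finrank volume ?_
  have hlip : LocallyLipschitzOn {θ : Fin k → W | ∀ j i, θ j ∈ interior (domain μ ℓ (a i))}
      (fun (θ : Fin k → W) (i : Fin m) => ∑ j, laplace μ ℓ (a i) (θ j)) := by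
    refine locallyLipschitzOn_pi fun i => ?_
    have h0 : ∀ J : Finset (Fin k), LocallyLipschitzOn
        {θ : Fin k → W | ∀ j i, θ j ∈ interior (domain μ ℓ (a i))}
        (fun θ => ∑ j ∈ J, laplace μ ℓ (a i) (θ j)) := by
      intro J
      induction J using Finset.induction_on with
      | empty => simpa using (LocallyLipschitz.const (0 : ℝ)).locallyLipschitzOn
      | insert j J hj ih =>
        simp only [Finset.sum_insert hj]
        refine LocallyLipschitzOn.add ?_ ih
        intro θ hθ
        obtain ⟨C, t, ht, hC⟩ := locallyLipschitzOn_laplace hℓ (ha i) (hθ j i)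
        have hmaps : Tendsto (fun θ : Fin k → W => θ j)
            (𝓝[{θ : Fin k → W | ∀ j i, θ j ∈ interior (domain μ ℓ (a i))}] θ)
            (𝓝[interior (domain μ ℓ (a i))] (θ j)) :=
          ((continuous_apply j).continuousWithinAt).tendsto_nhdsWithin fun θ hθ => hθ j i
        exact ⟨C * 1, _, hmaps ht, hC.comp (f := fun θ : Fin k → W => θ j)
          (LipschitzWith.eval j).lipschitzOnWith fun θ hθ => hθ⟩
    exact h0 Finset.univ
  refine (dimH_image_le_of_locally_lipschitzOn fun x hx => hlip hx).trans_lt ?_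
  refine (dimH_mono (Set.subset_univ _)).trans_lt ?_
  rw [Real.dimH_univ_eq_finrank, Module.finrank_fin_fun, Module.finrank_pi_fintype]
  simpa using mod_cast hk

end ExpFamily

/-! ### Gaussian densities as an exponential family -/

namespace MixtureMoment

variable {n : ℕ}

/-- The polynomial of degree at most two with coefficients `θ`, as a linear form in `θ`. -/
def quadForm (y : EuclideanSpace ℝ (Fin n)) : (Sym2 (Fin n) → ℝ) × (Fin n → ℝ) × ℝ →ₗ[ℝ] ℝ where
  toFun θ := -(1 / 2) * ∑ i, ∑ j, θ.1 s(i, j) * (y i * y j) + ∑ i, θ.2.1 i * y i + θ.2.2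
  map_add' θ θ' := by
    simp only [Prod.fst_add, Prod.snd_add, Pi.add_apply, add_mul, Finset.sum_add_distrib]
    ring
  map_smul' c θ := by
    simp only [Prod.smul_fst, Prod.smul_snd, Pi.smul_apply, smul_eq_mul, mul_assoc,
      ← Finset.mul_sum, RingHom.id_apply]
    ring

theorem quadForm_apply (y : EuclideanSpace ℝ (Fin n)) (θ : (Sym2 (Fin n) → ℝ) × (Fin n → ℝ) × ℝ) :
    quadForm y θ = -(1 / 2) * ∑ i, ∑ j, θ.1 s(i, j) * (y i * y j) + ∑ i, θ.2.1 i * y i + θ.2.2 := rfl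

theorem continuous_quadForm (θ : (Sym2 (Fin n) → ℝ) × (Fin n → ℝ) × ℝ) :
    Continuous fun y : EuclideanSpace ℝ (Fin n) => quadForm y θ := by
  simp only [quadForm_apply]
  fun_prop

theorem finrank_quadParams :
    Module.finrank ℝ ((Sym2 (Fin n) → ℝ) × (Fin n → ℝ) × ℝ) * 2 = (n + 1) * (n + 2) := by
  simp only [Module.finrank_prod, Module.finrank_fintype_fun_eq_card, Sym2.card, Fintype.card_fin,
    Module.finrank_self, Nat.choose_two_right]
  have := Nat.div_two_mul_two_of_even (Nat.even_mul_pred_self (n + 1))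
  rw [add_mul, this]
  simp
  ring

theorem abs_quadForm_le (y : EuclideanSpace ℝ (Fin n)) (θ : (Sym2 (Fin n) → ℝ) × (Fin n → ℝ) × ℝ) :
    |quadForm y θ| ≤ ‖θ‖ * ((n + 1) ^ 2 * (1 + ‖y‖ ^ 2)) := by
  have hy : ∀ i, |y i| ≤ ‖y‖ := fun i => by simpa using PiLp.norm_apply_le y i
  have h1 : ∀ z, |θ.1 z| ≤ ‖θ‖ := fun z => (norm_le_pi_norm θ.1 z).trans (norm_fst_le θ)
  have h2 : ∀ i, |θ.2.1 i| ≤ ‖θ‖ := fun i =>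
    (norm_le_pi_norm θ.2.1 i).trans ((norm_fst_le θ.2).trans (norm_snd_le θ))
  have h3 : |θ.2.2| ≤ ‖θ‖ := (norm_snd_le θ.2).trans (norm_snd_le θ)
  have e1 : |∑ i, ∑ j, θ.1 s(i, j) * (y i * y j)| ≤ n * (n * (‖θ‖ * (‖y‖ * ‖y‖))) := by
    refine (Finset.abs_sum_le_sum_abs _ _).trans ?_
    refine (Finset.sum_le_card_nsmul _ _ (n * (‖θ‖ * (‖y‖ * ‖y‖))) fun i _ => ?_).trans (by simp)
    refine (Finset.abs_sum_le_sum_abs _ _).trans ?_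
    refine (Finset.sum_le_card_nsmul _ _ (‖θ‖ * (‖y‖ * ‖y‖)) fun j _ => ?_).trans (by simp)
    rw [abs_mul, abs_mul]
    gcongr
    exacts [h1 _, hy i, hy j]
  have e2 : |∑ i, θ.2.1 i * y i| ≤ n * (‖θ‖ * ‖y‖) := by
    refine (Finset.abs_sum_le_sum_abs _ _).trans ?_
    refine (Finset.sum_le_card_nsmul _ _ (‖θ‖ * ‖y‖) fun i _ => ?_).trans (by simp)
    rw [abs_mul]
    gcongr
    exacts [h2 _, hy i]
  rw [quadForm_apply]
  have e3 : |-(1 / 2) * ∑ i, ∑ j, θ.1 s(i, j) * (y i * y j) + ∑ i, θ.2.1 i * y i + θ.2.2| ≤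
      1 / 2 * (n * (n * (‖θ‖ * (‖y‖ * ‖y‖)))) + n * (‖θ‖ * ‖y‖) + ‖θ‖ := by
    refine (abs_add_three _ _ _).trans ?_
    rw [abs_mul]
    norm_num
    linarith
  refine e3.trans ?_
  have hθ := norm_nonneg θ
  have hn : (0 : ℝ) ≤ n := Nat.cast_nonneg n
  have e4 : 1 / 2 * (n * (n * (‖y‖ * ‖y‖))) + n * ‖y‖ + 1 ≤ ((n : ℝ) + 1) ^ 2 * (1 + ‖y‖ ^ 2) := by
    nlinarith [sq_nonneg (‖y‖ - 1), sq_nonneg ‖y‖, mul_nonneg hn (sq_nonneg (‖y‖ - 1)),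
      mul_nonneg hn (sq_nonneg ‖y‖), mul_nonneg (mul_nonneg hn hn) (sq_nonneg ‖y‖), mul_nonneg hn hn]
  calc _ = ‖θ‖ * (1 / 2 * (n * (n * (‖y‖ * ‖y‖))) + n * ‖y‖ + 1) := by ring
    _ ≤ _ := by gcongr

theorem isSymm_inv_mul_inv {σ : Matrix (Fin n) (Fin n) ℝ} (hσ : σ.IsSymm) : (σ⁻¹ * σ⁻¹).IsSymm := by
  have h1 : σ⁻¹.transpose = σ⁻¹ := by rw [Matrix.transpose_nonsing_inv, hσ]
  rw [Matrix.IsSymm, Matrix.transpose_mul, h1]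

/-- The precision matrix `σ⁻²` as a function on unordered pairs of indices. -/
def precision (σ : Matrix (Fin n) (Fin n) ℝ) (hσ : σ.IsSymm) : Sym2 (Fin n) → ℝ :=
  Sym2.lift ⟨fun i j => (σ⁻¹ * σ⁻¹) i j, fun i j => (isSymm_inv_mul_inv hσ).apply j i⟩

/-- The natural parameters of `c` times the Gaussian density. -/
def gaussianParam (c : ℝ) (ξ : EuclideanSpace ℝ (Fin n)) (σ : Matrix (Fin n) (Fin n) ℝ)
    (hσ : σ.IsSymm) : (Sym2 (Fin n) → ℝ) × (Fin n → ℝ) × ℝ :=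
  (precision σ hσ, Matrix.mulVec (σ⁻¹ * σ⁻¹) ξ.ofLp,
    Real.log (c / Real.sqrt ((2 * Real.pi) ^ n * σ.det ^ 2)) -
      1 / 2 * (ξ.ofLp ⬝ᵥ Matrix.mulVec (σ⁻¹ * σ⁻¹) ξ.ofLp))

theorem sum_precision (σ : Matrix (Fin n) (Fin n) ℝ) (hσ : σ.IsSymm) (y : EuclideanSpace ℝ (Fin n)) :
    ∑ i, ∑ j, precision σ hσ s(i, j) * (y i * y j) =
      y.ofLp ⬝ᵥ Matrix.mulVec (σ⁻¹ * σ⁻¹) y.ofLp := by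
  simp only [dotProduct, Matrix.mulVec, Finset.mul_sum, precision, Sym2.lift_mk]
  refine Finset.sum_congr rfl fun i _ => Finset.sum_congr rfl fun j _ => ?_
  ring

theorem exp_quadForm_gaussianParam {c : ℝ} (hc : 0 < c) (ξ : EuclideanSpace ℝ (Fin n))
    {σ : Matrix (Fin n) (Fin n) ℝ} (hσ : σ ∈ symNonsing n) (y : EuclideanSpace ℝ (Fin n)) :
    Real.exp (quadForm y (gaussianParam c ξ σ hσ.1)) = c * gaussianDensity ξ σ y := by
  have hdet : 0 < σ.det ^ 2 := by
    have := hσ.2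
    positivity
  have hs : 0 < Real.sqrt ((2 * Real.pi) ^ n * σ.det ^ 2) := Real.sqrt_pos.2 (by positivity)
  have h3 : ξ.ofLp ⬝ᵥ Matrix.mulVec (σ⁻¹ * σ⁻¹) y.ofLp =
      y.ofLp ⬝ᵥ Matrix.mulVec (σ⁻¹ * σ⁻¹) ξ.ofLp := by
    rw [Matrix.dotProduct_mulVec, ← Matrix.mulVec_transpose, isSymm_inv_mul_inv hσ.1, dotProduct_comm]
  have h4 : ∑ i, Matrix.mulVec (σ⁻¹ * σ⁻¹) ξ.ofLp i * y i =
      y.ofLp ⬝ᵥ Matrix.mulVec (σ⁻¹ * σ⁻¹) ξ.ofLp := by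
    rw [dotProduct_comm]
    rfl
  rw [quadForm_apply]
  simp only [gaussianParam]
  rw [sum_precision, h4]
  have h5 : ∀ A B C : ℝ, -(1 / 2) * A + B + (Real.log (c / Real.sqrt ((2 * Real.pi) ^ n * σ.det ^ 2)) -
      1 / 2 * C) = -(1 / 2) * (A - 2 * B + C) +
      Real.log (c / Real.sqrt ((2 * Real.pi) ^ n * σ.det ^ 2)) := fun A B C => by ring
  rw [h5, Real.exp_add, Real.exp_log (by positivity), gaussianDensity]
  have h6 : (y - ξ).ofLp ⬝ᵥ Matrix.mulVec (σ⁻¹ * σ⁻¹) (y - ξ).ofLp =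
      y.ofLp ⬝ᵥ Matrix.mulVec (σ⁻¹ * σ⁻¹) y.ofLp - 2 * y.ofLp ⬝ᵥ Matrix.mulVec (σ⁻¹ * σ⁻¹) ξ.ofLp +
      ξ.ofLp ⬝ᵥ Matrix.mulVec (σ⁻¹ * σ⁻¹) ξ.ofLp := by
    rw [WithLp.ofLp_sub, Matrix.mulVec_sub, sub_dotProduct, dotProduct_sub, dotProduct_sub, h3]
    ring
  rw [h6]
  ring

theorem gaussianDensity_nonneg (ξ : EuclideanSpace ℝ (Fin n)) (σ : Matrix (Fin n) (Fin n) ℝ)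
    (y : EuclideanSpace ℝ (Fin n)) : 0 ≤ gaussianDensity ξ σ y := by
  unfold gaussianDensity
  positivity

theorem continuous_gaussianDensity (ξ : EuclideanSpace ℝ (Fin n)) (σ : Matrix (Fin n) (Fin n) ℝ) :
    Continuous (gaussianDensity ξ σ) := by
  unfold gaussianDensity
  simp only [dotProduct, Matrix.mulVec]
  fun_prop

theorem integrable_gaussianMeasure_iff (ξ : EuclideanSpace ℝ (Fin n)) (σ : Matrix (Fin n) (Fin n) ℝ)
    (g : EuclideanSpace ℝ (Fin n) → ℝ) :
    Integrable g (gaussianMeasure ξ σ) ↔ Integrable fun y => g y * gaussianDensity ξ σ y := by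
  rw [gaussianMeasure, integrable_withDensity_iff_integrable_smul'
    (continuous_gaussianDensity ξ σ).measurable.ennreal_ofReal (by simp)]
  simp [ENNReal.toReal_ofReal, gaussianDensity_nonneg, mul_comm]

theorem integral_gaussianMeasure (ξ : EuclideanSpace ℝ (Fin n)) (σ : Matrix (Fin n) (Fin n) ℝ)
    (g : EuclideanSpace ℝ (Fin n) → ℝ) :
    ∫ y, g y ∂(gaussianMeasure ξ σ) = ∫ y, g y * gaussianDensity ξ σ y := by
  rw [gaussianMeasure, integral_withDensity_eq_integral_toReal_smul
    (continuous_gaussianDensity ξ σ).measurable.ennreal_ofReal (by simp)]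
  simp [ENNReal.toReal_ofReal, gaussianDensity_nonneg, mul_comm]

end MixtureMoment

namespace MixtureMoment

variable {n : ℕ}

theorem exists_norm_sq_le_precision {σ : Matrix (Fin n) (Fin n) ℝ} (hσ : σ ∈ symNonsing n) :
    ∃ κ > 0, ∀ y : EuclideanSpace ℝ (Fin n),
      κ * ‖y‖ ^ 2 ≤ y.ofLp ⬝ᵥ Matrix.mulVec (σ⁻¹ * σ⁻¹) y.ofLp := by
  let T := Matrix.toEuclideanCLM (𝕜 := ℝ) σ
  -- With `z = σ⁻¹ y` the form equals `‖z‖ ^ 2`, and `y = σ z`. The summand `1` keeps the constant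
  -- positive when `T = 0`, as for `n = 0`.
  refine ⟨(‖T‖ ^ 2 + 1)⁻¹, by positivity, fun y => ?_⟩
  set z : EuclideanSpace ℝ (Fin n) := WithLp.toLp 2 (Matrix.mulVec σ⁻¹ y.ofLp) with hz
  have hTz : T z = y := by
    ext i
    simp [T, hz, Matrix.mulVec_mulVec, Matrix.mul_nonsing_inv σ (isUnit_iff_ne_zero.2 hσ.2)]
  have hzz : y.ofLp ⬝ᵥ Matrix.mulVec (σ⁻¹ * σ⁻¹) y.ofLp = ‖z‖ ^ 2 := by
    have h1 : σ⁻¹.transpose = σ⁻¹ := by rw [Matrix.transpose_nonsing_inv, hσ.1]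
    rw [← Matrix.mulVec_mulVec, Matrix.dotProduct_mulVec, ← Matrix.mulVec_transpose, h1,
      EuclideanSpace.real_norm_sq_eq]
    simp [dotProduct, hz, sq]
  rw [hzz, inv_mul_le_iff₀ (by positivity)]
  have h2 : ‖y‖ ≤ ‖T‖ * ‖z‖ := by
    rw [← hTz]
    exact T.le_opNorm z
  nlinarith [pow_le_pow_left₀ (norm_nonneg y) h2 2, sq_nonneg ‖z‖]

/-- A wider Gaussian leaves room for an additional factor `exp (ε ‖y‖ ^ 2)`; this is the margin
needed to perturb the natural parameters. -/
theorem exists_exp_quadForm_add_le {c : ℝ} (ξ : EuclideanSpace ℝ (Fin n))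
    {σ : Matrix (Fin n) (Fin n) ℝ} (hσ : σ ∈ symNonsing n) :
    ∃ ε > 0, ∃ ξ' : EuclideanSpace ℝ (Fin n), ∃ σ' ∈ symNonsing n, ∃ K, ∀ y,
      Real.exp (quadForm y (gaussianParam c ξ σ hσ.1) + ε * ‖y‖ ^ 2) ≤ K * gaussianDensity ξ' σ' y := by
  obtain ⟨κ, hκ, hκy⟩ := exists_norm_sq_le_precision hσ
  have hσ' : (2 : ℝ) • σ ∈ symNonsing n := by
    refine ⟨hσ.1.smul 2, ?_⟩
    rw [Matrix.det_smul]
    exact mul_ne_zero (by positivity) hσ.2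
  have hinv : ((2 : ℝ) • σ)⁻¹ * ((2 : ℝ) • σ)⁻¹ = (1 / 4 : ℝ) • (σ⁻¹ * σ⁻¹) := by
    have h1 : ((2 : ℝ) • σ)⁻¹ = (1 / 2 : ℝ) • σ⁻¹ := by
      refine Matrix.inv_eq_right_inv ?_
      rw [Matrix.smul_mul, Matrix.mul_smul, Matrix.mul_nonsing_inv σ (isUnit_iff_ne_zero.2 hσ.2),
        smul_smul]
      norm_num
    rw [h1, Matrix.smul_mul, Matrix.mul_smul, smul_smul]
    norm_num
  -- Doubling `σ` turns the coefficient `1/2` into `1/8`, with difference `3/8`; the centre `4 ξ`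
  -- keeps the linear term, and the constant matches the constant terms.
  refine ⟨3 / 8 * κ, by positivity, (4 : ℝ) • ξ, (2 : ℝ) • σ, hσ',
    Real.exp ((gaussianParam c ξ σ hσ.1).2.2 - (gaussianParam 1 ((4 : ℝ) • ξ) _ hσ'.1).2.2), fun y => ?_⟩
  have h1 := exp_quadForm_gaussianParam one_pos ((4 : ℝ) • ξ) hσ' y
  rw [one_mul] at h1
  rw [← h1, ← Real.exp_add, Real.exp_le_exp, quadForm_apply, quadForm_apply]
  simp only [gaussianParam]
  rw [sum_precision, sum_precision, hinv]
  have h2 : Matrix.mulVec ((1 / 4 : ℝ) • (σ⁻¹ * σ⁻¹)) ((4 : ℝ) • ξ).ofLp =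
      Matrix.mulVec (σ⁻¹ * σ⁻¹) ξ.ofLp := by
    rw [WithLp.ofLp_smul, Matrix.mulVec_smul, Matrix.smul_mulVec, smul_smul]
    norm_num
  rw [h2, Matrix.smul_mulVec, dotProduct_smul, smul_eq_mul]
  have h3 := hκy y
  linarith

/-- A perturbation of norm below `ε / (n + 1) ^ 2` changes the exponent by at most `ε (1 + ‖y‖ ^
2)`, so a wider Gaussian, against which `a` is integrable, dominates. -/
theorem gaussianParam_mem_interior {a : EuclideanSpace ℝ (Fin n) → ℝ} (ha : Continuous a)
    (hint : ∀ ξ, ∀ σ ∈ symNonsing n, Integrable a (gaussianMeasure ξ σ))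
    {c : ℝ} (ξ : EuclideanSpace ℝ (Fin n)) {σ : Matrix (Fin n) (Fin n) ℝ} (hσ : σ ∈ symNonsing n) :
    gaussianParam c ξ σ hσ.1 ∈ interior (ExpFamily.domain volume quadForm a) := by
  obtain ⟨ε, hε, ξ', σ', hσ', K, hK⟩ := exists_exp_quadForm_add_le (c := c) ξ hσ
  set θ₀ := gaussianParam c ξ σ hσ.1
  refine mem_interior.2 ⟨Metric.ball θ₀ (ε / (n + 1) ^ 2), ?_, Metric.isOpen_ball,
    Metric.mem_ball_self (by positivity)⟩
  intro θ hθ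
  have h1 := ((integrable_gaussianMeasure_iff ξ' σ' a).1 (hint ξ' σ' hσ')).norm.const_mul
    (Real.exp ε * K)
  refine h1.mono' (ha.mul (Real.continuous_exp.comp (continuous_quadForm θ))).aestronglyMeasurable
    (Eventually.of_forall fun y => ?_)
  have h2 : quadForm y θ ≤ ε + (quadForm y θ₀ + ε * ‖y‖ ^ 2) := by
    have h3 := le_of_abs_le (abs_quadForm_le y (θ - θ₀))
    rw [map_sub] at h3
    have h4 : ‖θ - θ₀‖ * (n + 1) ^ 2 ≤ ε := by
      rw [Metric.mem_ball, dist_eq_norm] at hθ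
      exact (le_div_iff₀ (by positivity)).1 hθ.le
    have h5 := mul_le_mul_of_nonneg_right h4 (by positivity : 0 ≤ 1 + ‖y‖ ^ 2)
    nlinarith
  rw [norm_mul, norm_mul, Real.norm_eq_abs, Real.norm_eq_abs, Real.norm_eq_abs, Real.abs_exp,
    abs_of_nonneg (gaussianDensity_nonneg _ _ _)]
  calc |a y| * Real.exp (quadForm y θ) ≤ |a y| * (Real.exp ε * (K * gaussianDensity ξ' σ' y)) := by
        gcongr
        refine (Real.exp_le_exp.2 h2).trans ?_
        rw [Real.exp_add]
        gcongr
        exact hK y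
    _ = _ := by ring

theorem momentMap_eq_sum_laplace {m k : ℕ} (a : Fin m → EuclideanSpace ℝ (Fin n) → ℝ)
    {q : (Fin k → ℝ) × (Fin k → EuclideanSpace ℝ (Fin n)) × (Fin k → Matrix (Fin n) (Fin n) ℝ)}
    (hq : q ∈ momentDomain Set.univ (symNonsing n) k) (hq0 : ∀ j, 0 < q.1 j) (i : Fin m) :
    momentMap Set.univ gaussianMeasure a k q i = ∑ j, ExpFamily.laplace volume quadForm (a i)
      (gaussianParam (q.1 j) (q.2.1 j) (q.2.2 j) (hq.2.2 j).1) := by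
  refine Finset.sum_congr rfl fun j _ => ?_
  simp only [momentFn, ExpFamily.laplace, Measure.restrict_univ]
  rw [integral_gaussianMeasure, ← integral_const_mul]
  refine integral_congr_ae (Eventually.of_forall fun y => ?_)
  simp only [exp_quadForm_gaussianParam (hq0 j) (q.2.1 j) (hq.2.2 j) y]
  ring

/-! ### Gaussian integrals determine continuous functions -/

theorem gaussianDensity_smul_one {s : ℝ} (hs : 0 < s) (ξ y : EuclideanSpace ℝ (Fin n)) :
    gaussianDensity ξ (s • 1) y = Real.exp (-(1 / (2 * s ^ 2)) * ‖y - ξ‖ ^ 2) /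
      Real.sqrt ((2 * Real.pi) ^ n * (s • (1 : Matrix (Fin n) (Fin n) ℝ)).det ^ 2) := by
  have h1 : (s • (1 : Matrix (Fin n) (Fin n) ℝ))⁻¹ = s⁻¹ • 1 := by
    refine Matrix.inv_eq_right_inv ?_
    rw [Matrix.smul_mul, Matrix.mul_smul, smul_smul, mul_one, mul_inv_cancel₀ hs.ne', one_smul]
  rw [gaussianDensity, h1, Matrix.smul_mul, Matrix.mul_smul, smul_smul, mul_one, Matrix.smul_mulVec,
    Matrix.one_mulVec, dotProduct_smul, EuclideanSpace.real_norm_sq_eq, smul_eq_mul]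
  congr 2
  simp only [dotProduct, ← sq]
  field_simp

theorem smul_one_mem_symNonsing {s : ℝ} (hs : 0 < s) :
    s • (1 : Matrix (Fin n) (Fin n) ℝ) ∈ symNonsing n := by
  refine ⟨Matrix.isSymm_one.smul s, ?_⟩
  rw [Matrix.det_smul, Matrix.det_one]
  positivity

/-- A continuous function is determined by its integrals against Gaussian measures. -/
theorem eq_zero_of_integral_gaussianMeasure_eq_zero {g : EuclideanSpace ℝ (Fin n) → ℝ}
    (hg : Continuous g) (hint : ∀ ξ, ∀ σ ∈ symNonsing n, Integrable g (gaussianMeasure ξ σ))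
    (h0 : ∀ ξ, ∀ σ ∈ symNonsing n, ∫ y, g y ∂(gaussianMeasure ξ σ) = 0)
    (ξ : EuclideanSpace ℝ (Fin n)) : g ξ = 0 := by
  have key : ∀ t : ℝ, 0 < t → Integrable (fun y => g y * Real.exp (-t * ‖y - ξ‖ ^ 2)) ∧
      ∫ y, g y * Real.exp (-t * ‖y - ξ‖ ^ 2) = 0 := by
    intro t ht
    set s := Real.sqrt (1 / (2 * t)) with hs
    have hs0 : 0 < s := Real.sqrt_pos.2 (by positivity)
    have hst : 1 / (2 * s ^ 2) = t := by
      rw [hs, Real.sq_sqrt (by positivity)]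
      field_simp
    set d := Real.sqrt ((2 * Real.pi) ^ n * (s • (1 : Matrix (Fin n) (Fin n) ℝ)).det ^ 2) with hd
    have hd0 : d ≠ 0 := by
      have := (smul_one_mem_symNonsing (n := n) hs0).2
      exact (Real.sqrt_pos.2 (by positivity)).ne'
    have he : (fun y => g y * Real.exp (-t * ‖y - ξ‖ ^ 2)) =
        fun y => d * (g y * gaussianDensity ξ (s • 1) y) := by
      ext y
      rw [gaussianDensity_smul_one hs0, hst, ← hd]
      field_simp
    have h1 := hint ξ _ (smul_one_mem_symNonsing hs0)
    have h2 := h0 ξ _ (smul_one_mem_symNonsing hs0)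
    rw [integrable_gaussianMeasure_iff] at h1
    rw [integral_gaussianMeasure] at h2
    rw [he, integral_const_mul, h2, mul_zero]
    exact ⟨h1.const_mul d, rfl⟩
  let φ : EuclideanSpace ℝ (Fin n) → ℝ := fun x => Real.exp (-Real.pi * ‖x‖ ^ 2)
  have hφ1 : ∫ x, φ x = 1 := by
    simp only [φ]
    rw [GaussianFourier.integral_rexp_neg_mul_sq_norm Real.pi_pos, div_self Real.pi_ne_zero,
      Real.one_rpow]
  have hφ2 : Tendsto (fun x : EuclideanSpace ℝ (Fin n) =>
      ‖x‖ ^ Module.finrank ℝ (EuclideanSpace ℝ (Fin n)) * φ x) (Bornology.cobounded _) (𝓝 0) := by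
    have h1 := (Real.tendsto_pow_mul_exp_neg_atTop_nhds_zero
      (Module.finrank ℝ (EuclideanSpace ℝ (Fin n)))).comp
      (tendsto_norm_cobounded_atTop (E := EuclideanSpace ℝ (Fin n)))
    refine squeeze_zero' (Eventually.of_forall fun x => by positivity) ?_ h1
    filter_upwards [(tendsto_norm_cobounded_atTop (E := EuclideanSpace ℝ (Fin n))).eventually_ge_atTop 1]
      with x hx
    simp only [φ, Function.comp_apply]
    gcongr
    nlinarith [Real.pi_gt_three]
  -- Approximate identity at `ξ`. As `g` itself need not be integrable, it is multiplied by a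
  -- Gaussian centred at `ξ`, which has value `1` there.
  have h3 := tendsto_integral_comp_smul_smul_of_integrable' (μ := volume) (φ := φ)
    (fun x => (Real.exp_pos _).le) hφ1 hφ2 (key Real.pi Real.pi_pos).1 (x₀ := ξ)
    (by fun_prop : Continuous fun y => g y * Real.exp (-Real.pi * ‖y - ξ‖ ^ 2)).continuousAt
  have h4 : ∀ c : ℝ, ∫ y, (c ^ Module.finrank ℝ (EuclideanSpace ℝ (Fin n)) * φ (c • (ξ - y))) •
      (g y * Real.exp (-Real.pi * ‖y - ξ‖ ^ 2)) = 0 := by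
    intro c
    -- The product of the two Gaussians is the Gaussian with `t = π (c ^ 2 + 1)`, to which `key`
    -- applies.
    rw [← mul_zero (c ^ Module.finrank ℝ (EuclideanSpace ℝ (Fin n))),
      ← (key (Real.pi * (c ^ 2 + 1)) (by positivity)).2, ← integral_const_mul]
    refine integral_congr_ae (Eventually.of_forall fun y => ?_)
    have h5 : -(Real.pi * (c ^ 2 + 1)) * ‖y - ξ‖ ^ 2 =
        -Real.pi * (c ^ 2 * ‖y - ξ‖ ^ 2) + -Real.pi * ‖y - ξ‖ ^ 2 := by ring
    simp only [φ, norm_smul, mul_pow, Real.norm_eq_abs, sq_abs, smul_eq_mul, norm_sub_rev ξ y]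
    rw [h5, Real.exp_add]
    ring
  simp only [h4] at h3
  simpa using (tendsto_nhds_unique h3 tendsto_const_nhds)

/-! ### The Gaussian bound -/

theorem linearIndependent_momentFn_gaussian {m : ℕ} {a : Fin m → EuclideanSpace ℝ (Fin n) → ℝ}
    (ha : ∀ i, Continuous (a i)) (hli : LinearIndependent ℝ a)
    (hint : ∀ i ξ, ∀ σ ∈ symNonsing n, Integrable (a i) (gaussianMeasure ξ σ)) :
    LinearIndependent ℝ (fun i => ((Set.univ : Set (EuclideanSpace ℝ (Fin n))) ×ˢ
      symNonsing n).domRestrict (momentFn Set.univ gaussianMeasure a i)) := by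
  refine Fintype.linearIndependent_iff.2 fun c hc => Fintype.linearIndependent_iff.1 hli c ?_
  ext ξ
  have h1 := eq_zero_of_integral_gaussianMeasure_eq_zero (g := fun y => ∑ i, c i * a i y)
    (by fun_prop) (fun ξ σ hσ => integrable_finsetSum _ fun i _ => (hint i ξ σ hσ).const_mul _)
    (fun ξ σ hσ => ?_) ξ
  · simpa [Finset.sum_apply] using h1
  · rw [integral_finsetSum _ fun i _ => (hint i ξ σ hσ).const_mul _]
    have h2 := congrFun hc ⟨(ξ, σ), Set.mem_univ _, hσ⟩
    simpa [Finset.sum_apply, momentFn, integral_const_mul] using h2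

theorem ceil_le_cara_gaussian {m : ℕ} {a : Fin m → EuclideanSpace ℝ (Fin n) → ℝ}
    (ha : ∀ i, Continuous (a i)) (hli : LinearIndependent ℝ a)
    (hint : ∀ i ξ, ∀ σ ∈ symNonsing n, Integrable (a i) (gaussianMeasure ξ σ)) :
    ((⌈(2 * m : ℚ) / ((n + 1) * (n + 2))⌉₊ : ℕ) : ℕ∞) ≤
      cara Set.univ (symNonsing n) gaussianMeasure a := by
  refine le_cara_of_volume_image_eq_zero (linearIndependent_momentFn_gaussian ha hli hint)
    fun k hk => ?_
  -- Below the ceiling, `k` components have fewer than `m` natural parameters in total.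
  have hkm : k * Module.finrank ℝ ((Sym2 (Fin n) → ℝ) × (Fin n → ℝ) × ℝ) < m := by
    rw [Nat.lt_ceil, lt_div_iff₀ (by positivity)] at hk
    have h1 : k * ((n + 1) * (n + 2)) < 2 * m := by exact_mod_cast hk
    rw [← finrank_quadParams] at h1
    nlinarith
  refine measure_mono_null ?_ (ExpFamily.volume_sum_laplace_eq_zero (μ := volume)
    (fun θ => (continuous_quadForm θ).measurable) (fun i => (ha i).measurable) hkm)
  rintro _ ⟨q, ⟨hq, hq0⟩, rfl⟩
  refine ⟨fun j => gaussianParam (q.1 j) (q.2.1 j) (q.2.2 j) (hq.2.2 j).1, fun j i =>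
    gaussianParam_mem_interior (ha i) (hint i) _ (hq.2.2 j), ?_⟩
  exact funext fun i => (momentMap_eq_sum_laplace a hq hq0 i).symm

end MixtureMoment

end

theorem mainTheorem5 :
    -- the general lower bound
    (∀ (n₁ n₂ m : ℕ)
      (X : Set (EuclideanSpace ℝ (Fin n₁))) (S : Set (EuclideanSpace ℝ (Fin n₂)))
      (δ : EuclideanSpace ℝ (Fin n₁) → EuclideanSpace ℝ (Fin n₂) →
        Measure (EuclideanSpace ℝ (Fin n₁)))
      (a : Fin m → EuclideanSpace ℝ (Fin n₁) → ℝ) (r : ℕ∞),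
      IsOpen X → IsOpen S →
      -- each `δ x σ` is a probability measure on `X`
      (∀ x ∈ X, ∀ σ ∈ S, IsProbabilityMeasure (δ x σ) ∧ δ x σ Xᶜ = 0) →
      -- the `a i` are continuous and linearly independent on `X`, with finite moments
      (∀ i, ContinuousOn (a i) X) →
      LinearIndependent ℝ (fun i => X.domRestrict (a i)) →
      (∀ i, ∀ x ∈ X, ∀ σ ∈ S, IntegrableOn (a i) X (δ x σ)) →
      -- Dirac measures are approximated as `σ → σ₀`
      (∃ σ₀ ∈ closure S, ∀ x ∈ X, ∀ i,
        Tendsto (fun σ => ∫ y in X, a i y ∂(δ x σ)) (𝓝[S] σ₀) (𝓝 (a i x))) →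
      -- the mixture moment functions are `C^r`, where `r > N (n₁ + n₂ + 1) - m`
      1 ≤ r →
      (∀ i, ContDiffOn ℝ r (MixtureMoment.momentFn X δ a i) (X ×ˢ S)) →
      MixtureMoment.rankNumber X S δ a * ((n₁ : ℕ∞) + n₂ + 1) < r + m →
      ((⌈(m : ℚ) / (n₁ + n₂ + 1)⌉₊ : ℕ) : ℕ∞) ≤ MixtureMoment.rankNumber X S δ a ∧
        MixtureMoment.rankNumber X S δ a ≤ MixtureMoment.cara X S δ a) ∧
    -- Gaussian mixtures
    (∀ (n m : ℕ) (a : Fin m → EuclideanSpace ℝ (Fin n) → ℝ),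
      (∀ i, Continuous (a i)) →
      LinearIndependent ℝ a →
      (∀ i ξ, ∀ σ ∈ MixtureMoment.symNonsing n,
        Integrable (a i) (MixtureMoment.gaussianMeasure ξ σ)) →
      ((⌈(2 * m : ℚ) / ((n + 1) * (n + 2))⌉₊ : ℕ) : ℕ∞) ≤
        MixtureMoment.cara Set.univ (MixtureMoment.symNonsing n)
          MixtureMoment.gaussianMeasure a) := by
  refine ⟨?_, fun n m a ha hli hint => MixtureMoment.ceil_le_cara_gaussian ha hli hint⟩
  intro n₁ n₂ m X S δ a r hX hS _ _ hli _ happ hr hC hN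
  exact ⟨MixtureMoment.ceil_le_rankNumber, MixtureMoment.rankNumber_le_cara hX hS
    (MixtureMoment.linearIndependent_momentFn_of_approx hli happ) hr hC hN⟩
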